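/- Digraphs have no loops and at most one edge in each direction between any two vertices. For a digraph $D$ on $V$ and $A,B\subseteq V$, let $D[A,B]$ be the digraph on $A\cup B$ whose edges are the edges $xy$ of $D$ with $x\in A$, $y\in B$; let $e_D(A,B)$ be the number of its edges and $e(D)$ the number of edges of $D$. Let $\epsilon>0$ and $d\in[0,1)$. For nonempty disjoint sets $A,B$ and a nonempty finite set $S$, a collection $\{F_c : c\in S\}$ of bipartite digraphs on the common vertex partition $A\cup B$ is called *$(\epsilon,d)$-regular* if $\sum_{c\in S}e_{F_c}(A,B)\ge d|S||A||B|$ and, whenever $A'\subseteq A$, $B'\subseteq B$, $S'\subseteq S$ satisfy $|A'|\ge\epsilon|A|$, $|B'|\ge\epsilon|B|$, $|S'|\ge\epsilon|S|$, $$\left|\frac{\sum_{c\in S'}e_{F_c}(A',B')}{|S'||A'||B'|}-\frac{\sum_{c\in S}e_{F_c}(A,B)}{|S||A||B|}\right|<\epsilon .$$ **Lemma (Regularity lemma for digraph collections).** For every integer $L_0\ge 1$ and all $\epsilon,\delta>0$ there is $n_0=n_0(\epsilon,\delta,L_0)$ such that the following holds for every $d\in[0,1)$ and every collection $\{D_c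 : c\in\mathcal C\}$ of (not necessarily distinct) digraphs on a common vertex set $V$ of size $n\ge n_0$ with $\delta n\le|\mathcal C|\le n/\delta$. There are a partition of $V$ into $V_0,V_1,\dots,V_L$, a partition of $\mathcal C$ into $\mathcal C_0,\mathcal C_1,\dots,\mathcal C_M$ (where only $V_0$ and $\mathcal C_0$ may be empty), and for each $c\in\mathcal C$ a spanning sub-digraph $D_c'$ of $D_c$ such that: (i) $L_0<L,M<n_0$ and $|V_0|+|\mathcal C_0|\le\epsilon n$; (ii) $|V_1|=\dots=|V_L|=|\mathcal C_1|=\dots=|\mathcal C_M|$; (iii) for all $v\in V$, $$\sum_{c\in\mathcal C}d^+_{D_c'}(v)\ge\sum_{c\in\mathcal C}d^+_{D_c}(v)-\Big(\frac{24d}{\delta^3}+\epsilon\Big)n^2,\qquad \sum_{c\in\mathcal C}d^-_{D_c'}(v)\ge\sum_{c\in\mathcal C}d^-_{D_c}(v)-\Big(\frac{24d}{\delta^3}+\epsilon\Big)n^2,$$ and $e(D_c')\ge e(D_c)-\big(\frac{24d}{\delta^3}+\epsilon\big)n^2$ for all $c\in\mathcal C$; (iv) for each $c\in\mathcal C$,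 if $D_c'$ has an edge with both end vertices in a single cluster $V_i$ with $1\le i\le L$, then $c\in\mathcal C_0$; (v) for all ordered pairs $(h,i)$ of distinct elements of $\{1,\dots,L\}$ and all $j\in\{1,\dots,M\}$, either $D_c'[V_h,V_i]$ has no edge for every $c\in\mathcal C_j$, or $\{D_c'[V_h,V_i] : c\in\mathcal C_j\}$ is $(\epsilon,d)$-regular. -/

import Mathlib

namespace DigraphCollection

/-- The digraph `D` has no loops. (`Digraph` already has at most one edge in each direction
between any two vertices.) -/
def Loopless {V : Type*} (D : Digraph V) : Prop :=
  ∀ v, ¬ D.Adj v v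

open Classical in
/-- The outdegree of `v` in `D`. -/
noncomputable def outDeg {V : Type*} [Fintype V] (D : Digraph V) (v : V) : ℕ :=
  (Finset.univ.filter fun w => D.Adj v w).card

open Classical in
/-- The indegree of `v` in `D`. -/
noncomputable def inDeg {V : Type*} [Fintype V] (D : Digraph V) (v : V) : ℕ :=
  (Finset.univ.filter fun w => D.Adj w v).card

open Classical in
/-- `e_D(A, B)`: the number of edges `xy` of `D` with `x ∈ A` and `y ∈ B`. -/
noncomputable def edgeCount {V : Type*} (D : Digraph V) (A B : Finset V) : ℕ :=
  ((A ×ˢ B).filter fun p => D.Adj p.1 p.2).card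

/-- `e(D)`: the number of edges of `D`. -/
noncomputable def numEdges {V : Type*} [Fintype V] (D : Digraph V) : ℕ :=
  edgeCount D Finset.univ Finset.univ

/-- `D[A, B]`: the edges `xy` of `D` with `x ∈ A` and `y ∈ B` (kept on the ambient vertex type;
vertices outside `A ∪ B` are isolated). -/
def between {V : Type*} (D : Digraph V) (A B : Finset V) : Digraph V where
  Adj x y := x ∈ A ∧ y ∈ B ∧ D.Adj x y

/-- The density `(∑_{c ∈ S} e_{D_c}(A, B)) / (|S| |A| |B|)` of the digraphs `D_c`, `c ∈ S`, from
`A` to `B`. -/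
noncomputable def density {V C : Type*} (D : C → Digraph V) (S : Finset C) (A B : Finset V) : ℝ :=
  (∑ c ∈ S, (edgeCount (D c) A B : ℝ)) / ((S.card : ℝ) * (A.card : ℝ) * (B.card : ℝ))

/-- The collection `{D_c : c ∈ S}` of bipartite digraphs with parts `A` and `B` is
`(ε, d)`-regular. -/
def IsRegular {V C : Type*} (ε d : ℝ) (D : C → Digraph V) (S : Finset C) (A B : Finset V) : Prop :=
  (∀ A' ⊆ A, ∀ B' ⊆ B, ∀ S' ⊆ S,
    ε * (A.card : ℝ) ≤ (A'.card : ℝ) →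
    ε * (B.card : ℝ) ≤ (B'.card : ℝ) →
    ε * (S.card : ℝ) ≤ (S'.card : ℝ) →
      |density D S' A' B' - density D S A B| < ε) ∧
  d * (S.card : ℝ) * (A.card : ℝ) * (B.card : ℝ) ≤ ∑ c ∈ S, (edgeCount (D c) A B : ℝ)

/-- `X₀, X 0, …, X (k - 1)` is a partition of the whole type: the sets are pairwise disjoint and
cover everything. The exceptional set `X₀` may be empty, the clusters `X i` may not. -/
structure IsClusterPartition {α : Type*} {k : ℕ} (X₀ : Finset α) (X : Fin k → Finset α) : Prop where
  nonempty : ∀ i, (X i).Nonempty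
  disjoint : ∀ i j, i ≠ j → Disjoint (X i) (X j)
  disjoint_exceptional : ∀ i, Disjoint X₀ (X i)
  cover : ∀ x, x ∈ X₀ ∨ ∃ i, x ∈ X i

end DigraphCollection

/-! The collection is read as one 0-1 function on `V × V × C`, with the colours as a third vertex
class; what is wanted is a degree form of Szemerédi's regularity lemma for this function.

The weak form, `exists_hasRegularClusters`, is an energy increment. If too many triples of clusters
are irregular, refining the partition by the witnesses raises the sum of squared fibre averages by a
fixed share of `|V × V × C|` (`energy_add_le`, `exists_refinement`). The energy never exceeds that
cardinality, so boundedly many rounds suffice. Only the labellings pass from one round to the next;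
the clusters are cut afresh from their fibres.

The losses must be small at every vertex and every colour, while irregular triples are rare only on
average. An element is therefore bad if too many of the triples through it are irregular or see it
with an atypically large degree. Double counting makes bad elements rare
(`sum_card_badElements_le`), so clusters with many of them are dropped and the others are shrunk to
avoid theirs (`exists_clean_clusters`). Then all edges are deleted in triples that join a cluster to
itself, are irregular, or are sparse. An element of a remaining cluster is good and loses little
(`sum_removed_le`); an exceptional element lies in no triple and loses nothing. Since clusters are
disjoint, a triple that is kept is untouched by the deletion, and it inherits regularity from the
original clusters by slicing. -/

namespace DigraphCollection

open Finset

/-! ### Densities and regularity of boxes. -/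

section Box

variable {X Y Z : Type*}

/-- The sum of `f` over the box `A × B × S`. -/
def boxSum (f : X → Y → Z → ℝ) (A : Finset X) (B : Finset Y) (S : Finset Z) : ℝ :=
  ∑ a ∈ A, ∑ b ∈ B, ∑ s ∈ S, f a b s

/-- The average of `f` over the box `A × B × S`. -/
noncomputable def boxDensity (f : X → Y → Z → ℝ) (A : Finset X) (B : Finset Y) (S : Finset Z) :
    ℝ :=
  boxSum f A B S / ((A.card : ℝ) * B.card * S.card)

/-- The average of `f` over any large sub-box is close to its average over `A × B × S`. -/
def BoxRegular (ε : ℝ) (f : X → Y → Z → ℝ) (A : Finset X) (B : Finset Y) (S : Finset Z) : Prop :=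
  ∀ A' ⊆ A, ∀ B' ⊆ B, ∀ S' ⊆ S,
    ε * (A.card : ℝ) ≤ (A'.card : ℝ) →
    ε * (B.card : ℝ) ≤ (B'.card : ℝ) →
    ε * (S.card : ℝ) ≤ (S'.card : ℝ) →
      |boxDensity f A' B' S' - boxDensity f A B S| < ε

/-- The permuted forms let one argument about the first coordinate serve tails, heads and colours
alike. -/
lemma boxDensity_swap (f : X → Y → Z → ℝ) (A : Finset X) (B : Finset Y) (S : Finset Z) :
    boxDensity (fun b a s => f a b s) B A S = boxDensity f A B S := by
  unfold boxDensity boxSum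
  rw [Finset.sum_comm, mul_comm (B.card : ℝ)]

lemma boxDensity_rotate (f : X → Y → Z → ℝ) (A : Finset X) (B : Finset Y) (S : Finset Z) :
    boxDensity (fun s a b => f a b s) S A B = boxDensity f A B S := by
  unfold boxDensity boxSum
  rw [Finset.sum_comm, show (S.card : ℝ) * A.card * B.card = A.card * B.card * S.card by ring]
  congr 1
  exact Finset.sum_congr rfl fun a _ => Finset.sum_comm

lemma BoxRegular.swap {ε : ℝ} {f : X → Y → Z → ℝ} {A : Finset X} {B : Finset Y} {S : Finset Z}
    (h : BoxRegular ε f A B S) : BoxRegular ε (fun b a s => f a b s) B A S := by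
  intro B' hB A' hA S' hS h1 h2 h3
  simpa only [boxDensity_swap] using h A' hA B' hB S' hS h2 h1 h3

lemma BoxRegular.rotate {ε : ℝ} {f : X → Y → Z → ℝ} {A : Finset X} {B : Finset Y} {S : Finset Z}
    (h : BoxRegular ε f A B S) : BoxRegular ε (fun s a b => f a b s) S A B := by
  intro S' hS A' hA B' hB h1 h2 h3
  simpa only [boxDensity_rotate] using h A' hA B' hB S' hS h2 h3 h1

lemma boxRegular_rotate_iff {ε : ℝ} {f : X → Y → Z → ℝ} {A : Finset X} {B : Finset Y}
    {S : Finset Z} : BoxRegular ε (fun s a b => f a b s) S A B ↔ BoxRegular ε f A B S :=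
  ⟨fun h => h.rotate.rotate, fun h => h.rotate⟩

/-- Passing to sub-boxes with sides at least half as long doubles the regularity parameter. -/
lemma BoxRegular.slice {ε : ℝ} (hε : 0 ≤ ε) (hε' : 2 * ε ≤ 1)
    {f : X → Y → Z → ℝ} {A A₁ : Finset X} {B B₁ : Finset Y}
    {S S₁ : Finset Z} (h : BoxRegular ε f A B S) (hA : A₁ ⊆ A) (hB : B₁ ⊆ B) (hS : S₁ ⊆ S)
    (hA' : (A.card : ℝ) ≤ 2 * A₁.card) (hB' : (B.card : ℝ) ≤ 2 * B₁.card)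
    (hS' : (S.card : ℝ) ≤ 2 * S₁.card) :
    BoxRegular (2 * ε) f A₁ B₁ S₁ ∧ |boxDensity f A₁ B₁ S₁ - boxDensity f A B S| < ε := by
  have key : ∀ {n m : ℝ}, 0 ≤ n → n ≤ 2 * m → ε * n ≤ m := fun h0 hn => by nlinarith
  have key2 : ∀ {n m l : ℝ}, n ≤ 2 * m → 2 * ε * m ≤ l → ε * n ≤ l := fun h0 hn => by nlinarith
  have h1 : |boxDensity f A₁ B₁ S₁ - boxDensity f A B S| < ε :=
    h _ hA _ hB _ hS (key (by positivity) hA') (key (by positivity) hB') (key (by positivity) hS')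
  refine ⟨fun A' hA1 B' hB1 S' hS1 e1 e2 e3 => ?_, h1⟩
  have h2 := h A' (hA1.trans hA) B' (hB1.trans hB) S' (hS1.trans hS)
    (key2 hA' e1) (key2 hB' e2) (key2 hS' e3)
  rw [abs_lt] at *
  constructor <;> linarith

/-- In a regular box few elements have a degree far above average. -/
lemma BoxRegular.card_atypical_le {ε : ℝ} (hε' : ε ≤ 1)
    {f : X → Y → Z → ℝ} {A : Finset X} {B : Finset Y} {S : Finset Z} (hB : B.Nonempty)
    (hS : S.Nonempty) (h : BoxRegular ε f A B S) (A' : Finset X) (hA' : A' ⊆ A)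
    (hA'f : ∀ a ∈ A', (boxDensity f A B S + ε) * (B.card * S.card) < ∑ b ∈ B, ∑ s ∈ S, f a b s) :
    (A'.card : ℝ) ≤ ε * A.card := by
  by_contra! hlt
  have hBp : (0 : ℝ) < B.card := by exact_mod_cast hB.card_pos
  have hSp : (0 : ℝ) < S.card := by exact_mod_cast hS.card_pos
  -- An empty box has density `0` by default, so averaging needs `A'` nonempty. In the empty case
  -- regularity itself yields `0 < ε`, which contradicts `hlt`.
  rcases A'.eq_empty_or_nonempty with rfl | hne
  · have h0 := h ∅ (by simp) B subset_rfl S subset_rfl hlt.le (by nlinarith) (by nlinarith)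
    have : 0 < ε := lt_of_le_of_lt (abs_nonneg _) h0
    have : (0 : ℝ) ≤ ε * A.card := by positivity
    simp at hlt
    linarith
  have hAp : (0 : ℝ) < A'.card := by exact_mod_cast hne.card_pos
  have h1 := h A' hA' B subset_rfl S subset_rfl hlt.le (by nlinarith) (by nlinarith)
  have h2 : (A'.card : ℝ) * ((boxDensity f A B S + ε) * (B.card * S.card)) ≤ boxSum f A' B S := by
    rw [← nsmul_eq_mul]
    exact Finset.card_nsmul_le_sum _ _ _ fun a ha => (hA'f a ha).le
  have h3 : boxDensity f A B S + ε ≤ boxDensity f A' B S := by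
    rw [boxDensity.eq_1 f A' B S, le_div_iff₀ (by positivity)]
    linarith
  rw [abs_lt] at h1
  linarith

end Box

/-! ### Conditional averages and the energy of a partition. -/

section Average

variable {X ι κ : Type*} [Fintype X]

open Classical in
/-- The average of `f` over the fibre of `π` through `x`. -/
noncomputable def fiberAvg (f : X → ℝ) (π : X → ι) (x : X) : ℝ :=
  (∑ y with π y = π x, f y) / (#{y | π y = π x} : ℝ)

lemma fiberAvg_congr (f : X → ℝ) (π : X → ι) {x y : X} (h : π x = π y) :
    fiberAvg f π x = fiberAvg f π y := by
  unfold fiberAvg; rw [h]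

/-- Averaging over fibres preserves the sum over a union of fibres, weighted by a function
constant on fibres. -/
lemma sum_mul_fiberAvg (f : X → ℝ) (π : X → ι) (g : X → ℝ)
    (hg : ∀ x y, π x = π y → g x = g y) :
    ∑ x, g x * fiberAvg f π x = ∑ x, g x * f x := by
  classical
  -- Conditional expectation is self-adjoint: write the sum over pairs in a common fibre and
  -- exchange the two variables.
  have key : ∀ x, g x * fiberAvg f π x =
      ∑ y, if π y = π x then g y * f y / (#{z | π z = π y} : ℝ) else 0 := by
    intro x
    rw [← Finset.sum_filter, fiberAvg, mul_div_assoc', Finset.mul_sum, Finset.sum_div]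
    refine Finset.sum_congr rfl fun y hy => ?_
    simp only [mem_filter, mem_univ, true_and] at hy
    rw [hg y x hy, hy]
  simp_rw [key]
  rw [Finset.sum_comm]
  refine Finset.sum_congr rfl fun y _ => ?_
  rw [← Finset.sum_filter, Finset.sum_const, nsmul_eq_mul]
  have : (#{z | π z = π y} : ℝ) ≠ 0 := by
    have : 0 < #{z | π z = π y} := Finset.card_pos.mpr ⟨y, by simp⟩
    positivity
  rw [show (#{x | π y = π x} : ℝ) = #{z | π z = π y} by simp only [eq_comm]]
  field_simp

lemma sum_fiberAvg_of_saturated (f : X → ℝ) (π : X → ι) (W : Finset X)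
    (hW : ∀ x y, π x = π y → x ∈ W → y ∈ W) :
    ∑ x ∈ W, fiberAvg f π x = ∑ x ∈ W, f x := by
  classical
  have := sum_mul_fiberAvg f π (fun x => if x ∈ W then 1 else 0) (fun x y h => by
    by_cases hx : x ∈ W
    · simp [hx, hW x y h hx]
    · have hy : y ∉ W := fun hy => hx (hW y x h.symm hy)
      simp [hx, hy])
  simpa [ite_mul, ← Finset.sum_filter] using this

/-- The energy of the partition into the fibres of `π`. -/
noncomputable def energy (f : X → ℝ) (π : X → ι) : ℝ := ∑ x, fiberAvg f π x ^ 2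

lemma energy_le (f : X → ℝ) (hf0 : ∀ x, 0 ≤ f x) (hf1 : ∀ x, f x ≤ 1) (π : X → ι) :
    energy f π ≤ Fintype.card X := by
  classical
  have : ∀ x ∈ (univ : Finset X), fiberAvg f π x ^ 2 ≤ 1 := by
    intro x _
    have h0 : 0 ≤ fiberAvg f π x := div_nonneg (Finset.sum_nonneg fun y _ => hf0 y) (by positivity)
    have h1 : fiberAvg f π x ≤ 1 := by
      refine div_le_one_of_le₀ ?_ (by positivity)
      simpa using Finset.sum_le_card_nsmul _ f 1 fun y _ => hf1 y
    exact pow_le_one₀ h0 h1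
  simpa [energy] using Finset.sum_le_card_nsmul _ _ _ this

lemma energy_nonneg (f : X → ℝ) (π : X → ι) : 0 ≤ energy f π :=
  Finset.sum_nonneg fun _ _ => sq_nonneg _

/-- Pythagoras for refinements. -/
lemma energy_eq_add (f : X → ℝ) (π : X → ι) (ρ : X → κ) (h : ∀ x y, ρ x = ρ y → π x = π y) :
    energy f ρ = energy f π + ∑ x, (fiberAvg f ρ x - fiberAvg f π x) ^ 2 := by
  have h1 := sum_mul_fiberAvg f ρ (fiberAvg f π) fun x y e => fiberAvg_congr f π (h x y e)
  have h2 := sum_mul_fiberAvg f π (fiberAvg f π) fun x y e => fiberAvg_congr f π e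
  have h3 : ∑ x, (fiberAvg f ρ x - fiberAvg f π x) ^ 2 =
      energy f ρ + ∑ x, fiberAvg f π x * fiberAvg f π x
        - 2 * ∑ x, fiberAvg f π x * fiberAvg f ρ x := by
    rw [energy, Finset.mul_sum, ← Finset.sum_add_distrib, ← Finset.sum_sub_distrib]
    exact Finset.sum_congr rfl fun x _ => by ring
  have h4 : energy f π = ∑ x, fiberAvg f π x * fiberAvg f π x :=
    Finset.sum_congr rfl fun x _ => by ring
  rw [h3, h1, ← h2, h4]; ring

lemma energy_mono (f : X → ℝ) (π : X → ι) (ρ : X → κ) (h : ∀ x y, ρ x = ρ y → π x = π y) :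
    energy f π ≤ energy f ρ := by
  rw [energy_eq_add f π ρ h]
  exact le_add_of_nonneg_right (Finset.sum_nonneg fun _ _ => sq_nonneg _)

/-- Energy increment: disjoint sets `W t`, unions of fibres of the finer partition, on which the
average of `f` differs by at least `ε` from the (constant) coarser average. -/
lemma energy_add_le {τ : Type*} (f : X → ℝ) (π : X → ι) (ρ : X → κ)
    (h : ∀ x y, ρ x = ρ y → π x = π y) (T : Finset τ) (W : τ → Finset X) (D : τ → ℝ)
    (hdisj : (T : Set τ).PairwiseDisjoint W)
    (hsat : ∀ t ∈ T, ∀ x y, ρ x = ρ y → x ∈ W t → y ∈ W t)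
    (hD : ∀ t ∈ T, ∀ x ∈ W t, fiberAvg f π x = D t) {ε w : ℝ} (hε : 0 ≤ ε)
    (hw : ∀ t ∈ T, w ≤ (W t).card)
    (hdev : ∀ t ∈ T, ε * (W t).card ≤ |∑ x ∈ W t, f x - D t * (W t).card|) :
    energy f π + T.card * (ε ^ 2 * w) ≤ energy f ρ := by
  classical
  rw [energy_eq_add f π ρ h]
  gcongr
  calc T.card * (ε ^ 2 * w) = ∑ t ∈ T, ε ^ 2 * w := by rw [Finset.sum_const, nsmul_eq_mul]
    _ ≤ ∑ t ∈ T, ∑ x ∈ W t, (fiberAvg f ρ x - fiberAvg f π x) ^ 2 := by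
        refine Finset.sum_le_sum fun t ht => ?_
        refine (mul_le_mul_of_nonneg_left (hw t ht) (sq_nonneg ε)).trans ?_
        -- `W t` is a union of fine fibres, so the fine averages sum to the sum of `f` over it.
        -- Cauchy–Schwarz then turns the deviation `hdev` into a bound on the squares.
        have e1 : ∑ x ∈ W t, (fiberAvg f ρ x - fiberAvg f π x) =
            ∑ x ∈ W t, f x - D t * (W t).card := by
          rw [Finset.sum_sub_distrib, sum_fiberAvg_of_saturated f ρ _ (hsat t ht),
            Finset.sum_congr rfl (hD t ht), Finset.sum_const, nsmul_eq_mul, mul_comm (D t)]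
        have e2 := sq_sum_le_card_mul_sum_sq (s := W t)
          (f := fun x => fiberAvg f ρ x - fiberAvg f π x)
        rw [e1] at e2
        have e3 := hdev t ht
        have e4 : (ε * (W t).card) ^ 2 ≤ (∑ x ∈ W t, f x - D t * (W t).card) ^ 2 := by
          rw [← sq_abs (∑ x ∈ W t, f x - D t * (W t).card)]
          exact pow_le_pow_left₀ (by positivity) e3 2
        rcases (W t).eq_empty_or_nonempty with h0 | h0
        · simp [h0]
        have hp : (0 : ℝ) < (W t).card := by exact_mod_cast h0.card_pos
        refine le_of_mul_le_mul_left (le_trans (le_of_eq ?_) (e4.trans e2)) hp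
        ring
    _ = ∑ x ∈ T.biUnion W, (fiberAvg f ρ x - fiberAvg f π x) ^ 2 :=
        (Finset.sum_biUnion hdisj).symm
    _ ≤ ∑ x, (fiberAvg f ρ x - fiberAvg f π x) ^ 2 :=
        Finset.sum_le_univ_sum_of_nonneg fun _ => sq_nonneg _

end Average

/-! ### Cutting fibres into clusters of equal size. -/

section Chop

/-- Disjoint sets of size `m`. -/
structure IsClusterFamily {V : Type*} {L : ℕ} (m : ℕ) (A : Fin L → Finset V) : Prop where
  card_eq : ∀ i, (A i).card = m
  disjoint : ∀ i j, i ≠ j → Disjoint (A i) (A j)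

lemma IsClusterFamily.eq_of_mem {V : Type*} {L m : ℕ} {A : Fin L → Finset V}
    (h : IsClusterFamily m A) {i j : Fin L} {x : V} (hi : x ∈ A i) (hj : x ∈ A j) : i = j := by
  by_contra hne
  exact Finset.disjoint_left.mp (h.disjoint i j hne) hi hj

open Classical in
lemma IsClusterFamily.card_biUnion {V : Type*} {L m : ℕ} {A : Fin L → Finset V}
    (h : IsClusterFamily m A) : (univ.biUnion A).card = L * m := by
  rw [Finset.card_biUnion fun i _ j _ hij => h.disjoint i j hij]
  simp [h.card_eq]

open Classical in
lemma IsClusterFamily.mul_add_card_eq {V : Type*} [Fintype V] {L m : ℕ} {A : Fin L → Finset V}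
    (h : IsClusterFamily m A) : L * m + #{x | ∀ i, x ∉ A i} = Fintype.card V := by
  rw [← h.card_biUnion, ← Finset.card_add_card_compl (univ.biUnion A)]
  congr 2
  ext x
  simp

lemma IsClusterFamily.mul_le {V : Type*} [Fintype V] {L m : ℕ} {A : Fin L → Finset V}
    (h : IsClusterFamily m A) : L * m ≤ Fintype.card V := by
  classical
  rw [← h.card_biUnion]
  exact Finset.card_le_univ _

open Classical in
/-- The fibres of `p` can be cut into pieces of size `m`, up to fewer than `m` elements each. -/
lemma exists_isClusterFamily {V : Type*} [Fintype V] {k : ℕ} (p : V → Fin k) (m : ℕ) (hm : 0 < m) :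
    ∃ (L : ℕ) (A : Fin L → Finset V), IsClusterFamily m A ∧
      (∀ i, ∀ x ∈ A i, ∀ y ∈ A i, p x = p y) ∧ #{x | ∀ i, x ∉ A i} ≤ k * m := by
  -- Take a maximal family of such sets: a fibre with more than `m` uncovered elements would supply
  -- one more member.
  let good : Finset (Finset V) → Prop := fun F =>
    (∀ A ∈ F, A.card = m) ∧ (∀ A ∈ F, ∀ B ∈ F, A ≠ B → Disjoint A B) ∧
      ∀ A ∈ F, ∀ x ∈ A, ∀ y ∈ A, p x = p y
  obtain ⟨F, hF, hmax⟩ := Finset.exists_max_image (univ.filter good) Finset.card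
    ⟨∅, by simp [good]⟩
  simp only [mem_filter, mem_univ, true_and] at hF hmax
  obtain ⟨h1, h2, h3⟩ := hF
  let e := F.equivFin
  refine ⟨F.card, fun i => (e.symm i : Finset V), ⟨fun i => h1 _ (e.symm i).2, fun i j hij =>
    h2 _ (e.symm i).2 _ (e.symm j).2 fun h => hij (e.symm.injective (Subtype.ext h))⟩,
    fun i => h3 _ (e.symm i).2, ?_⟩
  rw [mul_comm]
  have hmem : ∀ x : V, (∀ i, x ∉ (e.symm i : Finset V)) → ∀ A ∈ F, x ∉ A := fun x hx A hA hxA =>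
    hx (e ⟨A, hA⟩) (by simpa using hxA)
  have hk : (univ : Finset (Fin k)).card = k := by simp
  rw [← hk]
  refine Finset.card_le_mul_card_image_of_maps_to (f := p) (fun _ _ => mem_univ _) m ?_
  intro j _
  by_contra! hlt
  obtain ⟨A, hA, hAc⟩ := Finset.exists_subset_card_eq hlt.le
  have hAF : ∀ B ∈ F, Disjoint A B := fun B hB => Finset.disjoint_left.mpr fun x hx => by
    have := hA hx
    simp only [mem_filter, mem_univ, true_and] at this
    exact hmem x this.1 B hB
  have hAne : A.Nonempty := Finset.card_pos.mp (hAc ▸ hm)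
  have hnot : A ∉ F := fun h => hAne.ne_empty (disjoint_self.mp (hAF A h))
  have := hmax (insert A F) ⟨?_, ?_, ?_⟩
  · rw [Finset.card_insert_of_notMem hnot] at this; omega
  · intro B hB
    rcases mem_insert.mp hB with rfl | hB
    exacts [hAc, h1 B hB]
  · intro B hB B' hB' hne
    rcases mem_insert.mp hB with e | hB <;> rcases mem_insert.mp hB' with e' | hB'
    exacts [absurd (e.trans e'.symm) hne, e ▸ hAF _ hB', e' ▸ (hAF _ hB).symm,
      h2 _ hB _ hB' hne]
  · intro B hB
    rcases mem_insert.mp hB with rfl | hB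
    · intro x hx y hy
      have hx := hA hx
      have hy := hA hy
      simp only [mem_filter, mem_univ, true_and] at hx hy
      rw [hx.2, hy.2]
    · exact h3 B hB

end Chop

/-! ### One refinement step. -/

section Step

variable {V C : Type*}

/-- The partition of `V × V × C` induced by partitions of `V` and `C`. -/
def tripleLabel {ι κ : Type*} (p : V → ι) (q : C → κ) : V × V × C → ι × ι × κ :=
  fun x => (p x.1, p x.2.1, q x.2.2)

/-- A function of three variables as a function of a triple. -/
def uncurried (f : V → V → C → ℝ) : V × V × C → ℝ := fun x => f x.1 x.2.1 x.2.2

lemma sum_uncurried (f : V → V → C → ℝ) (A B : Finset V) (S : Finset C) :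
    ∑ x ∈ A ×ˢ B ×ˢ S, uncurried f x = boxSum f A B S := by
  simp [Finset.sum_product, uncurried, boxSum]

/-- The number of classes after refining `k` classes by at most `N` clusters and by the witnesses
of irregularity. -/
def refineBound (k N : ℕ) : ℕ := k * (2 ^ N * (2 ^ (N * (N * N)) * 2 ^ (N * (N * N))))

/-- If many triples of clusters are irregular, a bounded refinement gains energy. -/
lemma exists_refinement [Fintype V] [Fintype C] (f : V → V → C → ℝ) {k N : ℕ} (p : V → Fin k)
    (q : C → Fin k) {m L M : ℕ} {A : Fin L → Finset V} {S : Fin M → Finset C}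
    (hA : IsClusterFamily m A) (hS : IsClusterFamily m S)
    (hAp : ∀ i, ∀ x ∈ A i, ∀ y ∈ A i, p x = p y) (hSq : ∀ i, ∀ x ∈ S i, ∀ y ∈ S i, q x = q y)
    (hL : L ≤ N) (hM : M ≤ N) {ε : ℝ} (hε : 0 ≤ ε) (T : Finset (Fin L × Fin L × Fin M))
    (hT : ∀ t ∈ T, ¬ BoxRegular ε f (A t.1) (A t.2.1) (S t.2.2)) :
    ∃ (p' : V → Fin (refineBound k N)) (q' : C → Fin (refineBound k N)),
      energy (uncurried f) (tripleLabel p q) + T.card * (ε ^ 2 * (ε * m) ^ 3) ≤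
        energy (uncurried f) (tripleLabel p' q') := by
  classical
  have hwit : ∀ t : Fin L × Fin L × Fin M, ∃ (A' B' : Finset V) (S' : Finset C), t ∈ T →
      A' ⊆ A t.1 ∧ B' ⊆ A t.2.1 ∧ S' ⊆ S t.2.2 ∧ ε * m ≤ A'.card ∧ ε * m ≤ B'.card ∧
      ε * m ≤ S'.card ∧
      ε ≤ |boxDensity f A' B' S' - boxDensity f (A t.1) (A t.2.1) (S t.2.2)| := by
    intro t
    by_cases ht : t ∈ T
    · have := hT t ht
      unfold BoxRegular at this
      push Not at this
      obtain ⟨A', h1, B', h2, S', h3, h4, h5, h6, h7⟩ := this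
      rw [hA.card_eq] at h4 h5
      rw [hS.card_eq] at h6
      exact ⟨A', B', S', fun _ => ⟨h1, h2, h3, h4, h5, h6, h7⟩⟩
    · exact ⟨∅, ∅, ∅, fun h => absurd h ht⟩
  choose A' B' S' hw using hwit
  -- Two successive refinements. For `P₁`, `Q₁` each cluster is a single fibre, so fibre averages on
  -- cluster boxes are box densities; `P₂`, `Q₂` also separate the witnesses. The gain is measured
  -- between these two, and reaching the first costs no energy.
  let P₁ : V → Fin k × (Fin L → Prop) := fun v => (p v, fun i => v ∈ A i)
  let Q₁ : C → Fin k × (Fin M → Prop) := fun c => (q c, fun i => c ∈ S i)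
  let P₂ : V → Fin k × (Fin L → Prop) × (Fin L × Fin L × Fin M → Prop) ×
      (Fin L × Fin L × Fin M → Prop) :=
    fun v => (p v, fun i => v ∈ A i, fun t => v ∈ A' t, fun t => v ∈ B' t)
  let Q₂ : C → Fin k × (Fin M → Prop) × (Fin L × Fin L × Fin M → Prop) :=
    fun c => (q c, fun i => c ∈ S i, fun t => c ∈ S' t)
  have hcard : L * (L * M) ≤ N * (N * N) :=
    Nat.mul_le_mul hL (Nat.mul_le_mul hL hM)
  have hPc : Fintype.card (Fin k × (Fin L → Prop) × (Fin L × Fin L × Fin M → Prop) ×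
      (Fin L × Fin L × Fin M → Prop)) ≤ Fintype.card (Fin (refineBound k N)) := by
    rw [Fintype.card_fin (refineBound k N)]
    simp only [Fintype.card_prod, Fintype.card_fin, Fintype.card_pi, Finset.prod_const,
      Fintype.card_prop, Finset.card_univ, refineBound]
    have h2 := Nat.pow_le_pow_right (n := 2) (by norm_num) hcard
    exact Nat.mul_le_mul_left _ (Nat.mul_le_mul (Nat.pow_le_pow_right two_pos hL)
      (Nat.mul_le_mul h2 h2))
  have hQc : Fintype.card (Fin k × (Fin M → Prop) × (Fin L × Fin L × Fin M → Prop)) ≤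
      Fintype.card (Fin (refineBound k N)) := by
    rw [Fintype.card_fin (refineBound k N)]
    simp only [Fintype.card_prod, Fintype.card_fin, Fintype.card_pi, Finset.prod_const,
      Fintype.card_prop, Finset.card_univ, refineBound]
    have : 2 ^ (L * (L * M)) ≤ 2 ^ (N * (N * N)) * 2 ^ (N * (N * N)) :=
      (Nat.pow_le_pow_right two_pos hcard).trans
        (Nat.le_mul_of_pos_right _ (by positivity))
    exact Nat.mul_le_mul_left _ (Nat.mul_le_mul (Nat.pow_le_pow_right two_pos hM) this)
  obtain ⟨eP⟩ := Function.Embedding.nonempty_of_card_le hPc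
  obtain ⟨eQ⟩ := Function.Embedding.nonempty_of_card_le hQc
  refine ⟨fun v => eP (P₂ v), fun c => eQ (Q₂ c), ?_⟩
  have hlab : ∀ x y, tripleLabel (fun v => eP (P₂ v)) (fun c => eQ (Q₂ c)) x =
      tripleLabel (fun v => eP (P₂ v)) (fun c => eQ (Q₂ c)) y →
      P₂ x.1 = P₂ y.1 ∧ P₂ x.2.1 = P₂ y.2.1 ∧ Q₂ x.2.2 = Q₂ y.2.2 := by
    intro x y h
    simpa [tripleLabel] using h
  have hP21 : ∀ x y, P₂ x = P₂ y → P₁ x = P₁ y := fun x y h => by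
    simp only [P₁, P₂, Prod.mk.injEq] at h ⊢
    exact ⟨h.1, h.2.1⟩
  have hQ21 : ∀ x y, Q₂ x = Q₂ y → Q₁ x = Q₁ y := fun x y h => by
    simp only [Q₁, Q₂, Prod.mk.injEq] at h ⊢
    exact ⟨h.1, h.2.1⟩
  have hmono : energy (uncurried f) (tripleLabel p q) ≤
      energy (uncurried f) (tripleLabel P₁ Q₁) := by
    refine energy_mono _ _ _ fun x y h => ?_
    simp only [tripleLabel, P₁, Q₁, Prod.mk.injEq] at h ⊢
    exact ⟨h.1.1, h.2.1.1, h.2.2.1⟩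
  have hP1 : ∀ i, ∀ x ∈ A i, ∀ y, P₁ y = P₁ x ↔ y ∈ A i := by
    intro i x hx y
    simp only [P₁, Prod.mk.injEq]
    refine ⟨fun h => (iff_of_eq (congrFun h.2 i)).mpr hx, fun hy => ⟨hAp i y hy x hx, ?_⟩⟩
    funext j
    exact propext ⟨fun h => hA.eq_of_mem hy h ▸ hx, fun h => hA.eq_of_mem hx h ▸ hy⟩
  have hQ1 : ∀ i, ∀ x ∈ S i, ∀ y, Q₁ y = Q₁ x ↔ y ∈ S i := by
    intro i x hx y
    simp only [Q₁, Prod.mk.injEq]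
    refine ⟨fun h => (iff_of_eq (congrFun h.2 i)).mpr hx, fun hy => ⟨hSq i y hy x hx, ?_⟩⟩
    funext j
    exact propext ⟨fun h => hS.eq_of_mem hy h ▸ hx, fun h => hS.eq_of_mem hx h ▸ hy⟩
  refine (add_le_add_left hmono _).trans ?_
  refine energy_add_le (uncurried f) (tripleLabel P₁ Q₁) _ ?_ T
    (fun t => A' t ×ˢ B' t ×ˢ S' t) (fun t => boxDensity f (A t.1) (A t.2.1) (S t.2.2))
    ?_ ?_ ?_ hε ?_ ?_
  · intro x y h
    obtain ⟨h1, h2, h3⟩ := hlab x y h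
    simp only [tripleLabel, hP21 _ _ h1, hP21 _ _ h2, hQ21 _ _ h3]
  · intro t ht t' ht' hne
    refine Finset.disjoint_left.mpr fun x hx hx' => hne ?_
    simp only [mem_product] at hx hx'
    obtain ⟨a1, a2, a3, -⟩ := hw t ht
    obtain ⟨b1, b2, b3, -⟩ := hw t' ht'
    exact Prod.ext (hA.eq_of_mem (a1 hx.1) (b1 hx'.1))
      (Prod.ext (hA.eq_of_mem (a2 hx.2.1) (b2 hx'.2.1)) (hS.eq_of_mem (a3 hx.2.2) (b3 hx'.2.2)))
  · intro t _ x y h hx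
    obtain ⟨h1, h2, h3⟩ := hlab x y h
    simp only [P₂, Q₂, Prod.mk.injEq] at h1 h2 h3
    simp only [mem_product] at hx ⊢
    exact ⟨(iff_of_eq (congrFun h1.2.2.1 t)).mp hx.1, (iff_of_eq (congrFun h2.2.2.2 t)).mp hx.2.1,
      (iff_of_eq (congrFun h3.2.2 t)).mp hx.2.2⟩
  · intro t ht x hx
    obtain ⟨a1, a2, a3, -⟩ := hw t ht
    simp only [mem_product] at hx
    have hfib : (univ.filter fun y => tripleLabel P₁ Q₁ y = tripleLabel P₁ Q₁ x) =
        A t.1 ×ˢ A t.2.1 ×ˢ S t.2.2 := by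
      ext y
      rw [mem_filter, mem_product, mem_product]
      simp only [mem_univ, true_and, tripleLabel]
      rw [← hP1 _ _ (a1 hx.1) y.1, ← hP1 _ _ (a2 hx.2.1) y.2.1, ← hQ1 _ _ (a3 hx.2.2) y.2.2]
      simp only [Prod.mk.injEq (P₁ _)]
    unfold fiberAvg
    have hc : ∀ (d : DecidablePred fun y => tripleLabel P₁ Q₁ y = tripleLabel P₁ Q₁ x),
        @Finset.filter _ (fun y => tripleLabel P₁ Q₁ y = tripleLabel P₁ Q₁ x) d univ =
        A t.1 ×ˢ A t.2.1 ×ˢ S t.2.2 := fun d => by rw [← hfib]; congr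
    rw [hc, sum_uncurried, boxDensity]
    simp only [card_product, Nat.cast_mul, mul_assoc]
  · intro t ht
    obtain ⟨-, -, -, a4, a5, a6, -⟩ := hw t ht
    simp only [card_product, Nat.cast_mul]
    have h0 : 0 ≤ ε * m := by positivity
    calc (ε * m) ^ 3 = (ε * m) * ((ε * m) * (ε * m)) := by ring
      _ ≤ _ := by gcongr
  · intro t ht
    obtain ⟨-, -, -, -, -, -, a7⟩ := hw t ht
    rw [sum_uncurried]
    simp only [card_product, Nat.cast_mul]
    rcases eq_or_ne (((A' t).card : ℝ) * ((B' t).card * (S' t).card)) 0 with h0 | h0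
    · rw [h0]; simp
    have hpos : 0 < ((A' t).card : ℝ) * ((B' t).card * (S' t).card) :=
      lt_of_le_of_ne (by positivity) h0.symm
    have : boxSum f (A' t) (B' t) (S' t) = boxDensity f (A' t) (B' t) (S' t) *
        (((A' t).card : ℝ) * ((B' t).card * (S' t).card)) := by
      rw [← mul_assoc] at h0
      rw [boxDensity, ← mul_assoc (A' t).card.cast, div_mul_cancel₀ _ h0]
    rw [this, ← sub_mul, abs_mul, abs_of_pos hpos]
    gcongr

end Step

/-! ### Iteration until few triples are irregular. -/

section Iterate

/-- `V` and `C` contain disjoint clusters of a common size `m` between `n / N` and `η n`, missing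
few elements, such that few triples of clusters are irregular for `f`. -/
def HasRegularClusters {V C : Type*} [Fintype V] [Fintype C] (ε η : ℝ) (N : ℕ)
    (f : V → V → C → ℝ) : Prop :=
  ∃ (L M m : ℕ) (A : Fin L → Finset V) (S : Fin M → Finset C),
    0 < m ∧ IsClusterFamily m A ∧ IsClusterFamily m S ∧
    (m : ℝ) ≤ η * Fintype.card V ∧ Fintype.card V ≤ N * m ∧
    (Fintype.card V : ℝ) - L * m ≤ η * Fintype.card V ∧
    (Fintype.card C : ℝ) - M * m ≤ η * Fintype.card V ∧
    ∀ T : Finset (Fin L × Fin L × Fin M),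
      (∀ t ∈ T, ¬ BoxRegular ε f (A t.1) (A t.2.1) (S t.2.2)) → (T.card : ℝ) ≤ ε * (L * (L * M))

lemma HasRegularClusters.mono {V C : Type*} [Fintype V] [Fintype C] {ε η : ℝ} {N N' : ℕ}
    (hN : N ≤ N') {f : V → V → C → ℝ} (h : HasRegularClusters ε η N f) :
    HasRegularClusters ε η N' f := by
  obtain ⟨L, M, m, A, S, h1, h2, h3, h4, h5, h6⟩ := h
  exact ⟨L, M, m, A, S, h1, h2, h3, h4, h5.trans (Nat.mul_le_mul_right _ hN), h6⟩

/-- Bound for the number of clusters obtained by cutting `k` classes. -/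
noncomputable def cutBound (η δ : ℝ) (k : ℕ) : ℕ := ⌈2 * (k + 1) / (η * δ)⌉₊

/-- Clusters of size about `η n / (k + 1)` waste at most `η n` elements. By `2 * η ≤ δ` they still
cover half of `V` and half of `C`, so more than `ε L² M` irregular triples, each gaining `ε² (ε
m)³`, gain at least `ε⁶ / 8` of the total; the `8` is one factor `2` per coordinate. -/
lemma hasRegularClusters_or_refine {ε η δ : ℝ} (hε : 0 < ε) (hη : 0 < η) (hη1 : 2 * η ≤ δ)
    (hδ : δ ≤ 1) (k : ℕ)
    {V C : Type*} [Fintype V] [Fintype C] (f : V → V → C → ℝ) (hn : cutBound η δ k ≤ Fintype.card V)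
    (hC1 : δ * Fintype.card V ≤ Fintype.card C) (hC2 : (Fintype.card C : ℝ) ≤ Fintype.card V / δ)
    (p : V → Fin k) (q : C → Fin k) :
    HasRegularClusters ε η (cutBound η δ k) f ∨
      ∃ (p' : V → Fin (refineBound k (cutBound η δ k)))
        (q' : C → Fin (refineBound k (cutBound η δ k))),
        energy (uncurried f) (tripleLabel p q) + ε ^ 6 / 8 * Fintype.card (V × V × C) ≤
          energy (uncurried f) (tripleLabel p' q') := by
  classical
  set n := Fintype.card V with hndef
  set N := cutBound η δ k with hN
  have hδ0 : 0 < δ := by linarith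
  have hN1 : 2 * ((k : ℝ) + 1) / (η * δ) ≤ N := Nat.le_ceil _
  have hn' : (N : ℝ) ≤ n := by exact_mod_cast hn
  have hk : (0 : ℝ) < (k : ℝ) + 1 := by positivity
  have hηn : 2 * ((k : ℝ) + 1) ≤ η * δ * n := by
    rw [div_le_iff₀ (by positivity)] at hN1
    nlinarith [mul_pos hη hδ0]
  have hn0 : (0 : ℝ) ≤ n := Nat.cast_nonneg _
  have hηn' : 2 * ((k : ℝ) + 1) ≤ η * n := by
    refine hηn.trans ?_
    nlinarith [mul_nonneg hη.le hn0]
  set m := ⌊η * n / (k + 1)⌋₊ with hm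
  have hm1 : (m : ℝ) ≤ η * n / (k + 1) := Nat.floor_le (by positivity)
  have hm2 : η * n / (k + 1) < m + 1 := Nat.lt_floor_add_one _
  have h2 : 2 ≤ η * n / (k + 1) := by rw [le_div_iff₀ hk]; linarith
  have hm3 : η * n / (k + 1) ≤ 2 * m := by linarith
  have hm0 : 0 < m := by
    have : (0 : ℝ) < m := by linarith
    exact_mod_cast this
  have hm0' : (0 : ℝ) < m := by exact_mod_cast hm0
  have hkm : (k : ℝ) * m ≤ η * n := by
    rw [le_div_iff₀ hk] at hm1
    nlinarith
  have hmη : (m : ℝ) ≤ η * n := by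
    rw [le_div_iff₀ hk] at hm1
    nlinarith
  -- `cutBound` is made for this: both `n` and `|C|` are at most `n / δ`, so neither side has more
  -- than `N` clusters.
  have hNm : (n : ℝ) / δ ≤ N * m := by
    rw [div_le_iff₀ hk] at hm3
    rw [div_le_iff₀ (by positivity)] at hN1
    have h3 : 2 * ((k : ℝ) + 1) * m ≤ N * (η * δ) * m := by gcongr
    rw [div_le_iff₀ hδ0]
    have h4 : η * n ≤ η * (N * m * δ) := by nlinarith
    exact le_of_mul_le_mul_left h4 hη
  have hnδ : (n : ℝ) ≤ n / δ := by
    rw [le_div_iff₀ hδ0]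
    nlinarith
  obtain ⟨L, A, hA, hAp, hA'⟩ := exists_isClusterFamily p m hm0
  obtain ⟨M, S, hS, hSq, hS'⟩ := exists_isClusterFamily q m hm0
  have eA := hA.mul_add_card_eq
  have eS := hS.mul_add_card_eq
  have eA' : (n : ℝ) - L * m ≤ η * n := by
    have : (n : ℝ) ≤ L * m + k * m := by
      rw [hndef]
      exact_mod_cast eA.symm.le.trans (Nat.add_le_add_left hA' _)
    linarith
  have eS' : (Fintype.card C : ℝ) - M * m ≤ η * n := by
    have : (Fintype.card C : ℝ) ≤ M * m + k * m := by
      exact_mod_cast eS.symm.le.trans (Nat.add_le_add_left hS' _)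
    linarith
  have hLm : (L : ℝ) * m ≤ n := by exact_mod_cast hA.mul_le
  have hMm : (M : ℝ) * m ≤ Fintype.card C := by exact_mod_cast hS.mul_le
  have hLN : L ≤ N := by
    have : (L : ℝ) ≤ N := le_of_mul_le_mul_right (hLm.trans (hnδ.trans hNm)) hm0'
    exact_mod_cast this
  have hMN : M ≤ N := by
    have : (M : ℝ) ≤ N := le_of_mul_le_mul_right (hMm.trans (hC2.trans hNm)) hm0'
    exact_mod_cast this
  by_cases hgood : ∀ T : Finset (Fin L × Fin L × Fin M),
      (∀ t ∈ T, ¬ BoxRegular ε f (A t.1) (A t.2.1) (S t.2.2)) → (T.card : ℝ) ≤ ε * (L * (L * M))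
  · left
    refine ⟨L, M, m, A, S, hm0, hA, hS, hmη, ?_, eA', eS', hgood⟩
    exact_mod_cast hnδ.trans hNm
  · right
    push Not at hgood
    obtain ⟨T, hT, hTc⟩ := hgood
    obtain ⟨p', q', hpq⟩ := exists_refinement f p q hA hS hAp hSq hLN hMN hε.le T hT
    refine ⟨p', q', le_trans ?_ hpq⟩
    have hL2 : (n : ℝ) / 2 ≤ L * m := by nlinarith
    have hM2 : (Fintype.card C : ℝ) / 2 ≤ M * m := by nlinarith
    refine add_le_add le_rfl ?_
    rw [Fintype.card_prod, Fintype.card_prod, ← hndef]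
    push_cast
    calc ε ^ 6 / 8 * ((n : ℝ) * (n * Fintype.card C))
        = ε ^ 6 * ((n / 2) * ((n / 2) * (Fintype.card C / 2))) := by ring
      _ ≤ ε ^ 6 * ((L * m) * ((L * m) * (M * m))) := by gcongr
      _ = ε * (L * (L * M)) * (ε ^ 2 * (ε * m) ^ 3) := by ring
      _ ≤ T.card * (ε ^ 2 * (ε * m) ^ 3) := by gcongr

universe u v

/-- Here `r` counts the increments still available. The number of classes grows with each
refinement, so the induction is for all `k` at once. -/
lemma hasRegularClusters_of_energy {ε η δ : ℝ} (hε : 0 < ε) (hη : 0 < η) (hη1 : 2 * η ≤ δ)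
    (hδ : δ ≤ 1) (r : ℕ) : ∀ k : ℕ, ∃ N : ℕ, ∀ (V : Type u) (C : Type v) [Fintype V] [Fintype C]
      (f : V → V → C → ℝ), (∀ x y c, 0 ≤ f x y c) → (∀ x y c, f x y c ≤ 1) →
      N ≤ Fintype.card V → δ * Fintype.card V ≤ Fintype.card C →
      (Fintype.card C : ℝ) ≤ Fintype.card V / δ → ∀ (p : V → Fin k) (q : C → Fin k),
      (1 - r * (ε ^ 6 / 8)) * Fintype.card (V × V × C) ≤ energy (uncurried f) (tripleLabel p q) →
      HasRegularClusters ε η N f := by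
  have hδ0 : 0 < δ := by linarith
  induction r with
  | zero =>
    intro k
    -- The `+ 1` makes `V` nonempty, so a further increment would strictly exceed the maximal
    -- energy.
    refine ⟨cutBound η δ k + 1, fun V C _ _ f hf0 hf1 hn hC1 hC2 p q he => ?_⟩
    rcases hasRegularClusters_or_refine hε hη hη1 hδ k f (by omega) hC1 hC2 p q with
      h | ⟨p', q', h⟩
    · exact h.mono (Nat.le_succ _)
    · have h1 := energy_le (uncurried f) (fun x => hf0 _ _ _) (fun x => hf1 _ _ _)
        (tripleLabel p' q')
      have hVp : (0 : ℝ) < Fintype.card V := by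
        have : 0 < Fintype.card V := by omega
        exact_mod_cast this
      have hCp : (0 : ℝ) < Fintype.card C := lt_of_lt_of_le (by positivity) hC1
      have hX : (0 : ℝ) < Fintype.card (V × V × C) := by
        rw [Fintype.card_prod, Fintype.card_prod]
        push_cast
        positivity
      have : 0 < ε ^ 6 / 8 * Fintype.card (V × V × C) := by positivity
      simp only [Nat.cast_zero, zero_mul, sub_zero, one_mul] at he
      linarith
  | succ r ih =>
    intro k
    obtain ⟨N, hN⟩ := ih (refineBound k (cutBound η δ k))
    refine ⟨max N (cutBound η δ k), fun V C _ _ f hf0 hf1 hn hC1 hC2 p q he => ?_⟩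
    rcases hasRegularClusters_or_refine hε hη hη1 hδ k f ((le_max_right _ _).trans hn) hC1 hC2 p q
      with h | ⟨p', q', h⟩
    · exact h.mono (le_max_right _ _)
    · refine (hN V C f hf0 hf1 ((le_max_left _ _).trans hn) hC1 hC2 p' q' ?_).mono (le_max_left _ _)
      push_cast at he
      linarith

/-- Weak regularity lemma. -/
theorem exists_hasRegularClusters {ε η δ : ℝ} (hε : 0 < ε) (hη : 0 < η) (hη1 : 2 * η ≤ δ)
    (hδ : δ ≤ 1) : ∃ N : ℕ, ∀ (V : Type u) (C : Type v) [Fintype V] [Fintype C]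
      (f : V → V → C → ℝ), (∀ x y c, 0 ≤ f x y c) → (∀ x y c, f x y c ≤ 1) →
      N ≤ Fintype.card V → δ * Fintype.card V ≤ Fintype.card C →
      (Fintype.card C : ℝ) ≤ Fintype.card V / δ → HasRegularClusters ε η N f := by
  -- Start from a single class, with so many rounds available that the energy required initially is
  -- nonpositive.
  obtain ⟨N, hN⟩ := hasRegularClusters_of_energy hε hη hη1 hδ ⌈(ε ^ 6 / 8)⁻¹⌉₊ 1
  refine ⟨N, fun V C _ _ f hf0 hf1 hn hC1 hC2 =>
    hN V C f hf0 hf1 hn hC1 hC2 (fun _ => 0) (fun _ => 0) ?_⟩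
  refine le_trans ?_ (energy_nonneg _ _)
  have h1 : (1 : ℝ) ≤ ⌈(ε ^ 6 / 8)⁻¹⌉₊ * (ε ^ 6 / 8) := by
    have := Nat.le_ceil (ε ^ 6 / 8)⁻¹
    rwa [inv_le_iff_one_le_mul₀ (by positivity)] at this
  exact mul_nonpos_of_nonpos_of_nonneg (by linarith) (Nat.cast_nonneg _)

end Iterate

/-! ### Elements with too many bad pairs. -/

section Bad

variable {X Y Z I J K : Type*}

/-- The degree of `x` into `B × S` is much larger than the average over `A`. -/
def IsAtypical (ε : ℝ) (f : X → Y → Z → ℝ) (A : Finset X) (B : Finset Y) (S : Finset Z) (x : X) :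
    Prop :=
  (boxDensity f A B S + ε) * (B.card * S.card) < ∑ b ∈ B, ∑ s ∈ S, f x b s

open Classical in
/-- The pairs of clusters for which the degree of `x` is not controlled by regularity. -/
noncomputable def badPairs [Fintype J] [Fintype K] (ε : ℝ) (f : X → Y → Z → ℝ) (A : Finset X)
    (B : J → Finset Y) (S : K → Finset Z) (x : X) : Finset (J × K) :=
  univ.filter fun t => ¬ BoxRegular ε f A (B t.1) (S t.2) ∨ IsAtypical ε f A (B t.1) (S t.2) x

open Classical in
/-- The elements of `A` with many bad pairs. -/
noncomputable def badElements [Fintype J] [Fintype K] (ε γ : ℝ) (f : X → Y → Z → ℝ) (A : Finset X)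
    (B : J → Finset Y) (S : K → Finset Z) : Finset X :=
  A.filter fun x =>
    γ * (Fintype.card J * Fintype.card K) < ((badPairs ε f A B S x).card : ℝ)

variable [Fintype I] [Fintype J] [Fintype K]

/-- There are few bad elements in total. -/
lemma sum_card_badElements_le {ε γ : ℝ} (hε0 : 0 ≤ ε) (hε1 : ε ≤ 1) (f : X → Y → Z → ℝ) {m : ℕ}
    (hm : 0 < m) {A : I → Finset X} {B : J → Finset Y} {S : K → Finset Z}
    (hA : ∀ i, (A i).card = m) (hB : ∀ i, (B i).card = m) (hS : ∀ i, (S i).card = m)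
    (hJ : 0 < Fintype.card J) (hK : 0 < Fintype.card K)
    (hirr : ∀ T : Finset (I × J × K), (∀ t ∈ T, ¬ BoxRegular ε f (A t.1) (B t.2.1) (S t.2.2)) →
      (T.card : ℝ) ≤ ε * (Fintype.card I * (Fintype.card J * Fintype.card K))) :
    γ * ∑ h, ((badElements ε γ f (A h) B S).card : ℝ) ≤ 2 * ε * (Fintype.card I * m) := by
  classical
  set JK : ℝ := Fintype.card J * Fintype.card K with hJK
  have hJKpos : 0 < JK := by positivity
  refine le_of_mul_le_mul_right ?_ hJKpos
  let T : Finset (I × J × K) := univ.filter fun t => ¬ BoxRegular ε f (A t.1) (B t.2.1) (S t.2.2)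
  have hT := hirr T fun t ht => (mem_filter.mp ht).2
  have step1 : ∀ h, γ * JK * ((badElements ε γ f (A h) B S).card : ℝ) ≤
      ∑ x ∈ A h, ((badPairs ε f (A h) B S x).card : ℝ) := by
    intro h
    calc γ * JK * ((badElements ε γ f (A h) B S).card : ℝ)
        = ∑ x ∈ badElements ε γ f (A h) B S, γ * JK := by
          rw [Finset.sum_const, nsmul_eq_mul, mul_comm]
      _ ≤ ∑ x ∈ badElements ε γ f (A h) B S, ((badPairs ε f (A h) B S x).card : ℝ) :=
          Finset.sum_le_sum fun x hx => (mem_filter.mp hx).2.le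
      _ ≤ _ := Finset.sum_le_sum_of_subset_of_nonneg (Finset.filter_subset _ _)
          fun _ _ _ => Nat.cast_nonneg _
  -- Double counting: a regular triple makes its pair bad for at most `ε m` elements, an irregular
  -- one for at most all `m`.
  have step2 : ∀ h, ∑ x ∈ A h, ((badPairs ε f (A h) B S x).card : ℝ) =
      ∑ t : J × K, (#{x ∈ A h | ¬ BoxRegular ε f (A h) (B t.1) (S t.2) ∨
        IsAtypical ε f (A h) (B t.1) (S t.2) x} : ℝ) := by
    intro h
    simp only [badPairs, Finset.card_filter, Nat.cast_sum]
    exact Finset.sum_comm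
  have step3 : ∀ h, ∀ t : J × K, (#{x ∈ A h | ¬ BoxRegular ε f (A h) (B t.1) (S t.2) ∨
        IsAtypical ε f (A h) (B t.1) (S t.2) x} : ℝ) ≤
      ε * m + (if (h, t) ∈ T then (m : ℝ) else 0) := by
    intro h t
    have hm0 : (0 : ℝ) ≤ ε * m := by positivity
    by_cases hreg : BoxRegular ε f (A h) (B t.1) (S t.2)
    · have h1 : (h, t) ∉ T := by simp [T, hreg]
      rw [if_neg h1, add_zero, ← hA h]
      refine hreg.card_atypical_le hε1 (Finset.card_pos.mp (by rw [hB]; exact hm))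
        (Finset.card_pos.mp (by rw [hS]; exact hm)) _ (Finset.filter_subset _ _) fun a ha => ?_
      exact (mem_filter.mp ha).2.resolve_left (not_not.mpr hreg)
    · have h1 : (h, t) ∈ T := by simp [T, hreg]
      rw [if_pos h1]
      have : (#{x ∈ A h | ¬ BoxRegular ε f (A h) (B t.1) (S t.2) ∨
        IsAtypical ε f (A h) (B t.1) (S t.2) x} : ℝ) ≤ m := by
        rw [← hA h]
        exact_mod_cast Finset.card_filter_le _ _
      linarith
  calc (γ * ∑ h, ((badElements ε γ f (A h) B S).card : ℝ)) * JK
      = ∑ h, γ * JK * ((badElements ε γ f (A h) B S).card : ℝ) := by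
        rw [Finset.mul_sum, Finset.sum_mul]
        exact Finset.sum_congr rfl fun _ _ => by ring
    _ ≤ ∑ h, ∑ t : J × K, (ε * m + (if (h, t) ∈ T then (m : ℝ) else 0)) :=
        Finset.sum_le_sum fun h _ => (step1 h).trans ((step2 h).le.trans
          (Finset.sum_le_sum fun t _ => step3 h t))
    _ = ∑ x : I × J × K, (ε * m + (if x ∈ T then (m : ℝ) else 0)) :=
        (Fintype.sum_prod_type' fun h t => (ε * m + (if (h, t) ∈ T then (m : ℝ) else 0))).symm
    _ = (Fintype.card I * JK) * (ε * m) + T.card * m := by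
        rw [Finset.sum_add_distrib, Finset.sum_const, Finset.sum_ite_mem, Finset.univ_inter,
          Finset.sum_const, nsmul_eq_mul, nsmul_eq_mul, Finset.card_univ, Fintype.card_prod,
          Fintype.card_prod]
        push_cast
        ring
    _ ≤ (Fintype.card I * JK) * (ε * m) + (ε * (Fintype.card I * JK)) * m := by gcongr
    _ = 2 * ε * (Fintype.card I * m) * JK := by ring

/-- Edges at a good element which lie in irregular or sparse triples of clusters are few. -/
lemma sum_removed_le [Fintype Y] [Fintype Z] {ε γ d : ℝ} (hd : 0 ≤ d + 2 * ε)
    {f : X → Y → Z → ℝ} (hf0 : ∀ x y z, 0 ≤ f x y z) (hf1 : ∀ x y z, f x y z ≤ 1) {m : ℕ}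
    {A : Finset X} {B : J → Finset Y} {S : K → Finset Z}
    (hB : ∀ i, (B i).card = m) (hS : ∀ i, (S i).card = m) {x : X} (hxA : x ∈ A)
    (hx : x ∉ badElements ε γ f A B S) (g r : Y → Z → ℝ) (hr : ∀ y z, 0 ≤ r y z)
    (hg : ∀ y z, g y z ≤ r y z ∨ ∃ i j, y ∈ B i ∧ z ∈ S j ∧ g y z ≤ f x y z ∧
      (BoxRegular ε f A (B i) (S j) → boxDensity f A (B i) (S j) ≤ d + ε)) :
    ∑ y, ∑ z, g y z ≤
      (d + 2 * ε + γ) * ((Fintype.card J * m) * (Fintype.card K * m)) + ∑ y, ∑ z, r y z := by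
  classical
  -- `P` holds the pairs whose triple is irregular or sparse. If such a pair is not bad for `x`, its
  -- triple is regular, hence sparse, and `x` has at most `(d + 2ε) m²` there. Bad pairs are at most
  -- a share `γ` and get the trivial bound `m²`.
  let P : Finset (J × K) := univ.filter fun t =>
    BoxRegular ε f A (B t.1) (S t.2) → boxDensity f A (B t.1) (S t.2) ≤ d + ε
  have hbad : ((badPairs ε f A B S x).card : ℝ) ≤ γ * (Fintype.card J * Fintype.card K) := by
    by_contra! h
    exact hx (mem_filter.mpr ⟨hxA, h⟩)
  have hpt : ∀ y z, g y z ≤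
      ∑ t ∈ P, (if y ∈ B t.1 then if z ∈ S t.2 then f x y z else 0 else 0) + r y z := by
    intro y z
    have hnn : ∀ t ∈ P, 0 ≤ (if y ∈ B t.1 then if z ∈ S t.2 then f x y z else 0 else 0) := by
      intro t _
      split_ifs
      exacts [hf0 _ _ _, le_rfl, le_rfl]
    rcases hg y z with h | ⟨i, j, hi, hj, h1, h2⟩
    · linarith [Finset.sum_nonneg hnn]
    · have h3 := Finset.single_le_sum hnn (show (i, j) ∈ P from mem_filter.mpr ⟨mem_univ _, h2⟩)
      simp only [hi, hj, if_true] at h3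
      linarith [hr y z]
  have hsum : ∑ y, ∑ z, g y z ≤ ∑ t ∈ P, ∑ b ∈ B t.1, ∑ s ∈ S t.2, f x b s + ∑ y, ∑ z, r y z := by
    refine (Finset.sum_le_sum fun y _ => Finset.sum_le_sum fun z _ => hpt y z).trans
      (le_of_eq ?_)
    simp only [Finset.sum_add_distrib]
    congr 1
    rw [Finset.sum_congr rfl fun y _ => Finset.sum_comm, Finset.sum_comm]
    refine Finset.sum_congr rfl fun t _ => ?_
    rw [← Finset.sum_subset (Finset.subset_univ (B t.1)) fun y _ hy => by simp [hy]]
    refine Finset.sum_congr rfl fun y hy => ?_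
    simp only [hy, if_true, Finset.sum_ite_mem, Finset.univ_inter]
  refine hsum.trans (add_le_add_left ?_ _)
  have hterm : ∀ t ∈ P, ∑ b ∈ B t.1, ∑ s ∈ S t.2, f x b s ≤
      (d + 2 * ε) * ((m : ℝ) * m) + (if t ∈ badPairs ε f A B S x then (m : ℝ) * m else 0) := by
    intro t ht
    by_cases hb : t ∈ badPairs ε f A B S x
    · rw [if_pos hb]
      have : ∑ b ∈ B t.1, ∑ s ∈ S t.2, f x b s ≤ (m : ℝ) * m := by
        have h1 : ∀ b ∈ B t.1, ∑ s ∈ S t.2, f x b s ≤ m := fun b _ => by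
          simpa [hS] using Finset.sum_le_card_nsmul (S t.2) (f x b) 1 fun s _ => hf1 _ _ _
        simpa [hB] using Finset.sum_le_card_nsmul (B t.1) _ _ h1
      nlinarith [mul_nonneg hd (mul_self_nonneg (m : ℝ))]
    · rw [if_neg hb, add_zero]
      rw [badPairs, mem_filter] at hb
      simp only [mem_univ, true_and, not_or, not_not, IsAtypical, not_lt] at hb
      obtain ⟨hreg, hdeg⟩ := hb
      have hdens := (mem_filter.mp ht).2 hreg
      rw [hB, hS] at hdeg
      refine hdeg.trans (mul_le_mul_of_nonneg_right (by linarith) (by positivity))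
  calc ∑ t ∈ P, ∑ b ∈ B t.1, ∑ s ∈ S t.2, f x b s
      ≤ ∑ t ∈ P, ((d + 2 * ε) * ((m : ℝ) * m) +
          (if t ∈ badPairs ε f A B S x then (m : ℝ) * m else 0)) := Finset.sum_le_sum hterm
    _ ≤ ∑ t : J × K, ((d + 2 * ε) * ((m : ℝ) * m) +
          (if t ∈ badPairs ε f A B S x then (m : ℝ) * m else 0)) := by
        refine Finset.sum_le_sum_of_subset_of_nonneg (Finset.subset_univ _) fun t _ _ => ?_
        split_ifs <;> positivity
    _ = (Fintype.card J * Fintype.card K) * ((d + 2 * ε) * ((m : ℝ) * m)) +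
          (badPairs ε f A B S x).card * ((m : ℝ) * m) := by
        rw [Finset.sum_add_distrib, Finset.sum_const, Finset.sum_ite_mem, Finset.univ_inter,
          Finset.sum_const, nsmul_eq_mul, nsmul_eq_mul, Finset.card_univ, Fintype.card_prod]
        push_cast
        ring
    _ ≤ (Fintype.card J * Fintype.card K) * ((d + 2 * ε) * ((m : ℝ) * m)) +
          (γ * (Fintype.card J * Fintype.card K)) * ((m : ℝ) * m) := by gcongr
    _ = _ := by ring

end Bad

/-- Discard the clusters with many bad elements and shrink the others to avoid bad elements. -/
lemma exists_clean_clusters {V : Type*} {L m : ℕ} {A : Fin L → Finset V}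
    (hA : IsClusterFamily m A) (hm : 0 < m) {β : ℝ} (hβ0 : 0 < β)
    (Bad : Fin L → Finset V) (hBad : ∑ h, ((Bad h).card : ℝ) ≤ β ^ 2 * (L * m)) :
    ∃ (L₁ : ℕ) (e : Fin L₁ → Fin L) (A₁ : Fin L₁ → Finset V),
      IsClusterFamily (m - ⌊β * m⌋₊) A₁ ∧ (∀ i, A₁ i ⊆ A (e i)) ∧
      (∀ i, ∀ x ∈ A₁ i, x ∉ Bad (e i)) ∧ ((L : ℝ) - L₁) ≤ β * L := by
  classical
  -- By Markov, at most `β L` clusters have more than `β m` bad elements. Each other cluster gives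
  -- up exactly `⌊β m⌋₊` elements, which keeps the sizes equal.
  let G : Finset (Fin L) := univ.filter fun h => (Bad h).card ≤ ⌊β * m⌋₊
  let e : Fin G.card → Fin L := fun i => (G.equivFin.symm i : Fin L)
  have hinj : Function.Injective e := Subtype.val_injective.comp G.equivFin.symm.injective
  have hmem : ∀ i, e i ∈ G := fun i => (G.equivFin.symm i).2
  have hex : ∀ i, ∃ B ⊆ A (e i) \ Bad (e i), B.card = m - ⌊β * m⌋₊ := by
    intro i
    refine Finset.exists_subset_card_eq ?_
    have h1 := Finset.le_card_sdiff (Bad (e i)) (A (e i))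
    have h2 := (mem_filter.mp (hmem i)).2
    rw [hA.card_eq] at h1
    omega
  choose A₁ hA₁ hcard using hex
  have hsub : ∀ i, A₁ i ⊆ A (e i) := fun i => (hA₁ i).trans Finset.sdiff_subset
  refine ⟨G.card, e, A₁, ⟨hcard, fun i j hij => ?_⟩, hsub,
    fun i x hx => (mem_sdiff.mp (hA₁ i hx)).2, ?_⟩
  · exact Finset.disjoint_of_subset_left (hsub i) (Finset.disjoint_of_subset_right (hsub j)
      (hA.disjoint _ _ (hinj.ne hij)))
  · have hm' : (0 : ℝ) < m := by exact_mod_cast hm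
    have hc : (Gᶜ.card : ℝ) = L - G.card := by
      rw [Finset.card_compl, Fintype.card_fin, Nat.cast_sub]
      simpa using Finset.card_le_univ G
    have h1 : (Gᶜ.card : ℝ) * (β * m) ≤ ∑ h, ((Bad h).card : ℝ) := by
      rw [← nsmul_eq_mul]
      refine (Finset.card_nsmul_le_sum Gᶜ (fun h => ((Bad h).card : ℝ)) (β * m)
        fun h hh => ?_).trans
        (Finset.sum_le_univ_sum_of_nonneg fun _ => Nat.cast_nonneg _)
      simp only [G, mem_compl, mem_filter, mem_univ, true_and, not_le] at hh
      exact (Nat.lt_of_floor_lt hh).le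
    rw [hc] at h1
    have h2 : (β * m) * (L - G.card) ≤ (β * m) * (β * L) := by linarith
    exact le_of_mul_le_mul_left h2 (by positivity)

/-! ### Clean clusters and the weight of the removed edges. -/

section Clean

variable {V C : Type*}

/-- Clusters `A`, `S` of a common size `m`, and selected clusters `A₁`, `S₁` inside some of them, of
a common size `m₁ ≥ m / 2`, all of whose elements have few bad pairs. -/
structure CleanClusters (ε γ : ℝ) (f : V → V → C → ℝ) where
  (L M m L₁ M₁ m₁ : ℕ)
  (A : Fin L → Finset V)
  (S : Fin M → Finset C)
  (A₁ : Fin L₁ → Finset V)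
  (S₁ : Fin M₁ → Finset C)
  (eV : Fin L₁ → Fin L)
  (eC : Fin M₁ → Fin M)
  m₁_pos : 0 < m₁
  m₁_le : m₁ ≤ m
  le_m₁ : m ≤ 2 * m₁
  family_A : IsClusterFamily m A
  family_S : IsClusterFamily m S
  family_A₁ : IsClusterFamily m₁ A₁
  family_S₁ : IsClusterFamily m₁ S₁
  A₁_subset : ∀ i, A₁ i ⊆ A (eV i)
  S₁_subset : ∀ i, S₁ i ⊆ S (eC i)
  good_out : ∀ i, ∀ x ∈ A₁ i, x ∉ badElements ε γ f (A (eV i)) A S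
  good_in : ∀ i, ∀ x ∈ A₁ i, x ∉ badElements ε γ (fun y x c => f x y c) (A (eV i)) A S
  good_colour : ∀ j, ∀ c ∈ S₁ j, c ∉ badElements ε γ (fun c x y => f x y c) (S (eC j)) A A

/-- Bad elements are counted for out-degrees, in-degrees and colours, the irregular triples being
carried along by permuting coordinates. The conditions `hV` and `hC` ensure that there are clusters
on both sides. -/
lemma exists_cleanClusters [Fintype V] [Fintype C] {ε γ η β : ℝ} {N : ℕ}
    (hε0 : 0 ≤ ε) (hε1 : ε ≤ 1) (hγ : 0 < γ)
    (hβ0 : 0 < β) (hβ1 : 2 * β ≤ 1) (hεγ : 4 * ε ≤ γ * β ^ 2) (f : V → V → C → ℝ)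
    (hV : η * Fintype.card V < Fintype.card V) (hC : η * Fintype.card V < Fintype.card C)
    (h : HasRegularClusters ε η N f) :
    ∃ K : CleanClusters ε γ f,
      (K.m : ℝ) ≤ η * Fintype.card V ∧ Fintype.card V ≤ N * K.m ∧
      (Fintype.card V : ℝ) - K.L₁ * K.m₁ ≤ η * Fintype.card V + 2 * β * Fintype.card V ∧
      (Fintype.card C : ℝ) - K.M₁ * K.m₁ ≤ η * Fintype.card V + 2 * β * Fintype.card C := by
  classical
  obtain ⟨L, M, m, A, S, hm, hA, hS, hmη, hNm, hLm, hMm, hirr⟩ := h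
  have hm' : (0 : ℝ) < m := by exact_mod_cast hm
  have hL0 : 0 < L := by
    rcases Nat.eq_zero_or_pos L with rfl | h
    · simp at hLm; linarith
    · exact h
  have hM0 : 0 < M := by
    rcases Nat.eq_zero_or_pos M with rfl | h
    · simp at hMm; linarith
    · exact h
  -- Half of `β ^ 2` for each count, because vertices must avoid two bad sets, one for each
  -- direction.
  have bound : ∀ {b l : ℝ}, 0 ≤ l → γ * b ≤ 2 * ε * (l * m) → b ≤ β ^ 2 / 2 * (l * m) := by
    intro b l hl hb
    refine le_of_mul_le_mul_left (hb.trans ?_) hγ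
    nlinarith [mul_nonneg hl hm'.le]
  have hout := sum_card_badElements_le (γ := γ) hε0 hε1 f hm hA.card_eq hA.card_eq hS.card_eq
    (by simpa using hL0) (by simpa using hM0) (by simpa using hirr)
  have hin := sum_card_badElements_le (γ := γ) hε0 hε1 (fun y x c => f x y c) hm hA.card_eq
    hA.card_eq hS.card_eq (by simpa using hL0) (by simpa using hM0) (fun T hT => by
      simp only [Fintype.card_fin]
      let e : Fin L × Fin L × Fin M ↪ Fin L × Fin L × Fin M :=
        ⟨fun t => (t.2.1, t.1, t.2.2), fun t t' h => by
          simp only [Prod.mk.injEq] at h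
          exact Prod.ext h.2.1 (Prod.ext h.1 h.2.2)⟩
      have := hirr (T.map e) fun t ht => by
        obtain ⟨t, ht', rfl⟩ := Finset.mem_map.mp ht
        exact fun h => hT t ht' h.swap
      rwa [Finset.card_map] at this)
  have hcol := sum_card_badElements_le (γ := γ) hε0 hε1 (fun c x y => f x y c) hm hS.card_eq
    hA.card_eq hA.card_eq (by simpa using hL0) (by simpa using hL0) (fun T hT => by
      simp only [Fintype.card_fin]
      let e : Fin M × Fin L × Fin L ↪ Fin L × Fin L × Fin M :=
        ⟨fun t => (t.2.1, t.2.2, t.1), fun t t' h => by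
          simp only [Prod.mk.injEq] at h
          exact Prod.ext h.2.2 (Prod.ext h.1 h.2.1)⟩
      have := hirr (T.map e) fun t ht => by
        obtain ⟨t, ht', rfl⟩ := Finset.mem_map.mp ht
        exact fun h => hT t ht' h.rotate
      rw [Finset.card_map] at this
      exact this.trans (le_of_eq (by ring)))
  simp only [Fintype.card_fin] at hout hin hcol
  have hout := bound (Nat.cast_nonneg _) hout
  have hin := bound (Nat.cast_nonneg _) hin
  have hcol := bound (Nat.cast_nonneg _) hcol
  obtain ⟨L₁, eV, A₁, hA₁, hA₁A, hA₁g, hL₁⟩ := exists_clean_clusters hA hm hβ0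
    (fun h => badElements ε γ f (A h) A S ∪ badElements ε γ (fun y x c => f x y c) (A h) A S) (by
      calc ∑ h, ((badElements ε γ f (A h) A S ∪
            badElements ε γ (fun y x c => f x y c) (A h) A S).card : ℝ)
          ≤ ∑ h, (((badElements ε γ f (A h) A S).card : ℝ) +
            (badElements ε γ (fun y x c => f x y c) (A h) A S).card) :=
            Finset.sum_le_sum fun h _ => by exact_mod_cast Finset.card_union_le _ _
        _ ≤ β ^ 2 * (L * m) := by rw [Finset.sum_add_distrib]; linarith)
  obtain ⟨M₁, eC, S₁, hS₁, hS₁S, hS₁g, hM₁⟩ := exists_clean_clusters hS hm hβ0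
    (fun h => badElements ε γ (fun c x y => f x y c) (S h) A A)
    (hcol.trans (by nlinarith [mul_nonneg (Nat.cast_nonneg (α := ℝ) M) hm'.le, sq_nonneg β]))
  have hfl : (⌊β * m⌋₊ : ℝ) ≤ β * m := Nat.floor_le (by positivity)
  have hflm : ⌊β * m⌋₊ ≤ m := by
    have : (⌊β * m⌋₊ : ℝ) ≤ m := by nlinarith
    exact_mod_cast this
  have hm₁ : ((m - ⌊β * m⌋₊ : ℕ) : ℝ) = m - ⌊β * m⌋₊ := Nat.cast_sub hflm
  have hhalf : (m : ℝ) ≤ 2 * (m - ⌊β * m⌋₊ : ℕ) := by rw [hm₁]; nlinarith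
  have hhalf' : m ≤ 2 * (m - ⌊β * m⌋₊) := by exact_mod_cast hhalf
  -- One factor `1 - β` is for dropped clusters and one for shrinking; `(1 - β)² ≥ 1 - 2β`.
  have hlow : ∀ {l l₁ : ℝ}, 0 ≤ l → l - l₁ ≤ β * l →
      l * m - l₁ * (m - ⌊β * m⌋₊ : ℕ) ≤ 2 * β * (l * m) := by
    intro l l₁ hl h
    rw [hm₁]
    have h1 : (1 - β) * l ≤ l₁ := by linarith
    have h2 : (1 - β) * m ≤ m - ⌊β * m⌋₊ := by linarith
    have h3 : ((1 - β) * l) * ((1 - β) * m) ≤ l₁ * (m - ⌊β * m⌋₊) :=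
      mul_le_mul h1 h2 (mul_nonneg (by linarith) hm'.le)
        ((mul_nonneg (by linarith) hl).trans h1)
    nlinarith [mul_nonneg (mul_nonneg hl hm'.le) (sq_nonneg β)]
  have hLV : (L : ℝ) * m ≤ Fintype.card V := by exact_mod_cast hA.mul_le
  have hMC : (M : ℝ) * m ≤ Fintype.card C := by exact_mod_cast hS.mul_le
  refine ⟨⟨L, M, m, L₁, M₁, m - ⌊β * m⌋₊, A, S, A₁, S₁, eV, eC, by omega, Nat.sub_le _ _, hhalf',
    hA, hS, hA₁, hS₁, hA₁A, hS₁S, fun i x hx => ?_, fun i x hx => ?_, hS₁g⟩, hmη, hNm, ?_, ?_⟩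
  · exact fun h => hA₁g i x hx (mem_union_left _ h)
  · exact fun h => hA₁g i x hx (mem_union_right _ h)
  · have h1 := hlow (Nat.cast_nonneg _) hL₁
    have h2 := mul_le_mul_of_nonneg_left hLV (by positivity : 0 ≤ 2 * β)
    dsimp only
    linarith
  · have h1 := hlow (Nat.cast_nonneg _) hM₁
    have h2 := mul_le_mul_of_nonneg_left hMC (by positivity : 0 ≤ 2 * β)
    dsimp only
    linarith

namespace CleanClusters

variable {ε γ : ℝ} {f : V → V → C → ℝ} (K : CleanClusters ε γ f)

/-- The triples of clusters in which all edges are to be removed. -/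
def Discarded (d : ℝ) (h i : Fin K.L₁) (j : Fin K.M₁) : Prop :=
  -- Regularity is tested on the original clusters, where `badPairs` is measured, and density on the
  -- shrunken ones, which the final partition uses; `slice` links the two.
  h = i ∨ ¬ BoxRegular ε f (K.A (K.eV h)) (K.A (K.eV i)) (K.S (K.eC j)) ∨
    boxDensity f (K.A₁ h) (K.A₁ i) (K.S₁ j) < d

/-- The edge `xy` of colour `c` lies in a discarded triple. -/
def Removed (d : ℝ) (x y : V) (c : C) : Prop :=
  ∃ h i j, x ∈ K.A₁ h ∧ y ∈ K.A₁ i ∧ c ∈ K.S₁ j ∧ K.Discarded d h i j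

open Classical in
/-- The part of `f` that is removed. -/
noncomputable def removedPart (d : ℝ) (x y : V) (c : C) : ℝ :=
  if K.Removed d x y c then f x y c else 0

variable {K} {d : ℝ}

lemma slice (hε0 : 0 ≤ ε) (hε1 : 2 * ε ≤ 1) {h i : Fin K.L₁} {j : Fin K.M₁}
    (hreg : BoxRegular ε f (K.A (K.eV h)) (K.A (K.eV i)) (K.S (K.eC j))) :
    BoxRegular (2 * ε) f (K.A₁ h) (K.A₁ i) (K.S₁ j) ∧
      |boxDensity f (K.A₁ h) (K.A₁ i) (K.S₁ j) -
        boxDensity f (K.A (K.eV h)) (K.A (K.eV i)) (K.S (K.eC j))| < ε := by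
  have hm : (K.m : ℝ) ≤ 2 * K.m₁ := by exact_mod_cast K.le_m₁
  refine hreg.slice hε0 hε1 (K.A₁_subset h) (K.A₁_subset i) (K.S₁_subset j) ?_ ?_ ?_
  · rwa [K.family_A.card_eq, K.family_A₁.card_eq]
  · rwa [K.family_A.card_eq, K.family_A₁.card_eq]
  · rwa [K.family_S.card_eq, K.family_S₁.card_eq]

/-- A regular discarded triple of distinct clusters is sparse. -/
lemma Discarded.density_le (hε0 : 0 ≤ ε) (hε1 : 2 * ε ≤ 1) {h i : Fin K.L₁} {j : Fin K.M₁}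
    (hd : K.Discarded d h i j) (hne : h ≠ i)
    (hreg : BoxRegular ε f (K.A (K.eV h)) (K.A (K.eV i)) (K.S (K.eC j))) :
    boxDensity f (K.A (K.eV h)) (K.A (K.eV i)) (K.S (K.eC j)) ≤ d + ε := by
  have h1 := (slice hε0 hε1 hreg).2
  rw [abs_lt] at h1
  rcases hd with h | h | h
  exacts [absurd h hne, absurd hreg h, by linarith]

lemma removedPart_le (hf0 : ∀ x y c, 0 ≤ f x y c) (x y : V) (c : C) :
    K.removedPart d x y c ≤ f x y c := by
  unfold removedPart
  split_ifs
  exacts [le_rfl, hf0 _ _ _]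

lemma removedPart_of_not {x y : V} {c : C} (h : ¬ K.Removed d x y c) :
    K.removedPart d x y c = 0 := if_neg h

/-- A vertex of a selected cluster is good, so `sum_removed_le` applies; edges inside its own
cluster go into the slack function and give the term `m |C|`. Any other vertex loses nothing. -/
lemma sum_removedPart_out_le [Fintype V] [Fintype C] (hε0 : 0 ≤ ε) (hε1 : 2 * ε ≤ 1)
    (hd : 0 ≤ d) (hγ : 0 ≤ γ)
    (hf0 : ∀ x y c, 0 ≤ f x y c) (hf1 : ∀ x y c, f x y c ≤ 1) (v : V) :
    ∑ y, ∑ c, K.removedPart d v y c ≤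
      (d + 2 * ε + γ) * ((K.L * K.m) * (K.M * K.m)) + K.m * Fintype.card C := by
  classical
  by_cases hv : ∃ h, v ∈ K.A₁ h
  · obtain ⟨h, hv⟩ := hv
    refine (sum_removed_le (d := d) (by positivity) hf0 hf1 K.family_A.card_eq K.family_S.card_eq
      (K.A₁_subset h hv) (K.good_out h v hv) (K.removedPart d v)
      (fun y _ => if y ∈ K.A₁ h then 1 else 0) (fun y c => by split_ifs <;> norm_num)
      fun y c => ?_).trans ?_
    · by_cases hr : K.Removed d v y c
      · obtain ⟨h', i, j, hx, hy, hc, hdis⟩ := hr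
        obtain rfl := K.family_A₁.eq_of_mem hv hx
        by_cases hi : h = i
        · left
          rw [if_pos (hi ▸ hy)]
          exact (removedPart_le hf0 _ _ _).trans (hf1 _ _ _)
        · right
          exact ⟨_, _, K.A₁_subset i hy, K.S₁_subset j hc, removedPart_le hf0 _ _ _,
            hdis.density_le hε0 hε1 hi⟩
      · left
        rw [removedPart_of_not hr]
        split_ifs <;> norm_num
    · simp only [Fintype.card_fin]
      refine add_le_add le_rfl ?_
      have : (K.m₁ : ℝ) ≤ K.m := by exact_mod_cast K.m₁_le
      simp only [Finset.sum_const, Finset.card_univ, nsmul_eq_mul, ← Finset.mul_sum,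
        Finset.sum_ite_mem, Finset.univ_inter, K.family_A₁.card_eq, mul_one]
      rw [mul_comm]
      gcongr
  · rw [Finset.sum_eq_zero fun y _ => Finset.sum_eq_zero fun c _ =>
      removedPart_of_not fun ⟨h, _, _, hx, _⟩ => hv ⟨h, hx⟩]
    positivity

lemma sum_removedPart_in_le [Fintype V] [Fintype C] (hε0 : 0 ≤ ε) (hε1 : 2 * ε ≤ 1)
    (hd : 0 ≤ d) (hγ : 0 ≤ γ)
    (hf0 : ∀ x y c, 0 ≤ f x y c) (hf1 : ∀ x y c, f x y c ≤ 1) (v : V) :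
    ∑ x, ∑ c, K.removedPart d x v c ≤
      (d + 2 * ε + γ) * ((K.L * K.m) * (K.M * K.m)) + K.m * Fintype.card C := by
  classical
  by_cases hv : ∃ h, v ∈ K.A₁ h
  · obtain ⟨h, hv⟩ := hv
    refine (sum_removed_le (d := d) (by positivity) (fun _ _ _ => hf0 _ _ _)
      (fun _ _ _ => hf1 _ _ _) K.family_A.card_eq K.family_S.card_eq
      (K.A₁_subset h hv) (K.good_in h v hv) (fun x c => K.removedPart d x v c)
      (fun y _ => if y ∈ K.A₁ h then 1 else 0) (fun y c => by split_ifs <;> norm_num)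
      fun y c => ?_).trans ?_
    · by_cases hr : K.Removed d y v c
      · obtain ⟨i, h', j, hy, hx, hc, hdis⟩ := hr
        obtain rfl := K.family_A₁.eq_of_mem hv hx
        by_cases hi : i = h
        · left
          rw [if_pos (hi ▸ hy)]
          exact (removedPart_le hf0 _ _ _).trans (hf1 _ _ _)
        · right
          refine ⟨_, _, K.A₁_subset i hy, K.S₁_subset j hc, removedPart_le hf0 _ _ _,
            fun hreg => ?_⟩
          rw [boxDensity_swap]
          exact hdis.density_le hε0 hε1 hi hreg.swap
      · left
        rw [removedPart_of_not hr]
        split_ifs <;> norm_num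
    · simp only [Fintype.card_fin]
      refine add_le_add le_rfl ?_
      have : (K.m₁ : ℝ) ≤ K.m := by exact_mod_cast K.m₁_le
      simp only [Finset.sum_const, Finset.card_univ, nsmul_eq_mul, ← Finset.mul_sum,
        Finset.sum_ite_mem, Finset.univ_inter, K.family_A₁.card_eq, mul_one]
      rw [mul_comm]
      gcongr
  · rw [Finset.sum_eq_zero fun y _ => Finset.sum_eq_zero fun c _ =>
      removedPart_of_not fun ⟨_, h, _, _, hx, _⟩ => hv ⟨h, hx⟩]
    positivity

lemma sum_removedPart_colour_le [Fintype V] [Fintype C] (hε0 : 0 ≤ ε) (hε1 : 2 * ε ≤ 1)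
    (hd : 0 ≤ d) (hγ : 0 ≤ γ)
    (hf0 : ∀ x y c, 0 ≤ f x y c) (hf1 : ∀ x y c, f x y c ≤ 1) (c : C) :
    ∑ x, ∑ y, K.removedPart d x y c ≤
      (d + 2 * ε + γ) * ((K.L * K.m) * (K.L * K.m)) + K.m * Fintype.card V := by
  classical
  by_cases hc : ∃ j, c ∈ K.S₁ j
  · obtain ⟨j, hc⟩ := hc
    refine (sum_removed_le (d := d) (by positivity) (fun _ _ _ => hf0 _ _ _)
      (fun _ _ _ => hf1 _ _ _) K.family_A.card_eq K.family_A.card_eq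
      (K.S₁_subset j hc) (K.good_colour j c hc) (fun x y => K.removedPart d x y c)
      -- For a fixed colour the slack covers the inside edges of all clusters: at most `m` from each
      -- vertex.
      (fun x y => if ∃ h, x ∈ K.A₁ h ∧ y ∈ K.A₁ h then 1 else 0)
      (fun y c => by split_ifs <;> norm_num) fun x y => ?_).trans ?_
    · by_cases hr : K.Removed d x y c
      · obtain ⟨h, i, j', hx, hy, hc', hdis⟩ := hr
        obtain rfl := K.family_S₁.eq_of_mem hc hc'
        by_cases hi : h = i
        · left
          rw [if_pos ⟨h, hx, hi ▸ hy⟩]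
          exact (removedPart_le hf0 _ _ _).trans (hf1 _ _ _)
        · right
          refine ⟨_, _, K.A₁_subset h hx, K.A₁_subset i hy, removedPart_le hf0 _ _ _,
            fun hreg => ?_⟩
          rw [boxDensity_rotate]
          exact hdis.density_le hε0 hε1 hi (boxRegular_rotate_iff.mp hreg)
      · left
        rw [removedPart_of_not hr]
        split_ifs <;> norm_num
    · simp only [Fintype.card_fin]
      refine add_le_add le_rfl ?_
      have hrow : ∀ x ∈ (univ : Finset V),
          ∑ y, (if ∃ h, x ∈ K.A₁ h ∧ y ∈ K.A₁ h then (1 : ℝ) else 0) ≤ K.m := by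
        intro x _
        rw [Finset.sum_boole]
        by_cases hx : ∃ h, x ∈ K.A₁ h
        · obtain ⟨h, hx⟩ := hx
          have : #{y | ∃ h, x ∈ K.A₁ h ∧ y ∈ K.A₁ h} ≤ (K.A₁ h).card := by
            refine Finset.card_le_card fun y hy => ?_
            obtain ⟨h', hx', hy'⟩ := (mem_filter.mp hy).2
            rwa [K.family_A₁.eq_of_mem hx hx']
          rw [K.family_A₁.card_eq] at this
          exact_mod_cast this.trans K.m₁_le
        · rw [Finset.filter_false_of_mem fun y _ ⟨h, h1, _⟩ => hx ⟨h, h1⟩]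
          simp
      refine (Finset.sum_le_card_nsmul _ _ _ hrow).trans (le_of_eq ?_)
      rw [nsmul_eq_mul, Finset.card_univ, mul_comm]
  · rw [Finset.sum_eq_zero fun y _ => Finset.sum_eq_zero fun x _ =>
      removedPart_of_not fun ⟨_, _, j, _, _, hx, _⟩ => hc ⟨j, hx⟩]
    positivity

end CleanClusters

end Clean

/-! ### From functions back to digraphs: the pruned collection. -/

section Prune

variable {V C : Type*}

open Classical in
/-- The indicator function of a collection of digraphs. -/
noncomputable def edgeIndicator (D : C → Digraph V) (x y : V) (c : C) : ℝ :=
  if (D c).Adj x y then 1 else 0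

lemma edgeIndicator_nonneg (D : C → Digraph V) (x y : V) (c : C) : 0 ≤ edgeIndicator D x y c := by
  unfold edgeIndicator; split_ifs <;> norm_num

lemma edgeIndicator_le_one (D : C → Digraph V) (x y : V) (c : C) :
    edgeIndicator D x y c ≤ 1 := by
  unfold edgeIndicator; split_ifs <;> norm_num

lemma edgeCount_eq_sum (D : C → Digraph V) (A B : Finset V) (c : C) :
    (edgeCount (D c) A B : ℝ) = ∑ x ∈ A, ∑ y ∈ B, edgeIndicator D x y c := by
  rw [← Finset.sum_product', edgeCount, ← Finset.sum_boole]
  rfl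

lemma outDeg_eq_sum [Fintype V] (D : C → Digraph V) (v : V) (c : C) :
    (outDeg (D c) v : ℝ) = ∑ y, edgeIndicator D v y c := by
  rw [outDeg, ← Finset.sum_boole]
  rfl

lemma inDeg_eq_sum [Fintype V] (D : C → Digraph V) (v : V) (c : C) :
    (inDeg (D c) v : ℝ) = ∑ x, edgeIndicator D x v c := by
  rw [inDeg, ← Finset.sum_boole]
  rfl

lemma sum_edgeCount (D : C → Digraph V) (S : Finset C) (A B : Finset V) :
    ∑ c ∈ S, (edgeCount (D c) A B : ℝ) = boxSum (edgeIndicator D) A B S := by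
  simp only [edgeCount_eq_sum, boxSum]
  rw [Finset.sum_comm]
  exact Finset.sum_congr rfl fun x _ => Finset.sum_comm

lemma density_eq_boxDensity (D : C → Digraph V) (S : Finset C) (A B : Finset V) :
    density D S A B = boxDensity (edgeIndicator D) A B S := by
  rw [density, boxDensity, sum_edgeCount]
  congr 1
  ring

lemma density_congr {D D' : C → Digraph V} {S : Finset C} {A B : Finset V}
    (h : ∀ c ∈ S, ∀ x ∈ A, ∀ y ∈ B, ((D c).Adj x y ↔ (D' c).Adj x y)) :
    density D S A B = density D' S A B := by
  unfold density edgeCount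
  congr 1
  refine Finset.sum_congr rfl fun c hc => ?_
  congr 2
  ext p
  simp only [mem_filter, mem_product, and_congr_right_iff]
  exact fun hp => h c hc _ hp.1 _ hp.2

/-- Regularity on a box sees only the edges in that box, so it passes to a digraph collection
altered elsewhere. -/
lemma isRegular_congr {ε d : ℝ} {D D' : C → Digraph V} {S : Finset C} {A B : Finset V}
    (h : ∀ c ∈ S, ∀ x ∈ A, ∀ y ∈ B, ((D c).Adj x y ↔ (D' c).Adj x y))
    (hD : BoxRegular ε (edgeIndicator D) A B S) (hd : d ≤ boxDensity (edgeIndicator D) A B S) :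
    IsRegular ε d D' S A B := by
  have key : ∀ A' ⊆ A, ∀ B' ⊆ B, ∀ S' ⊆ S,
      density D' S' A' B' = boxDensity (edgeIndicator D) A' B' S' := fun A' hA B' hB S' hS => by
    rw [← density_eq_boxDensity]
    exact density_congr fun c hc x hx y hy => (h c (hS hc) x (hA hx) y (hB hy)).symm
  refine ⟨fun A' hA B' hB S' hS h1 h2 h3 => ?_, ?_⟩
  · rw [key A' hA B' hB S' hS, key A subset_rfl B subset_rfl S subset_rfl]
    exact hD A' hA B' hB S' hS h1 h2 h3
  · rw [← key A subset_rfl B subset_rfl S subset_rfl, density] at hd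
    rcases eq_or_ne ((S.card : ℝ) * A.card * B.card) 0 with h0 | h0
    · rw [show d * (S.card : ℝ) * A.card * B.card = d * (S.card * A.card * B.card) by ring, h0,
        mul_zero]
      exact Finset.sum_nonneg fun _ _ => Nat.cast_nonneg _
    · rw [le_div_iff₀ (lt_of_le_of_ne (by positivity) h0.symm)] at hd
      linarith

lemma BoxRegular.mono {X Y Z : Type*} {ε ε' : ℝ} (hε : ε ≤ ε') {f : X → Y → Z → ℝ}
    {A : Finset X} {B : Finset Y} {S : Finset Z} (h : BoxRegular ε f A B S) :
    BoxRegular ε' f A B S := fun A' hA B' hB S' hS h1 h2 h3 =>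
  (h A' hA B' hB S' hS ((mul_le_mul_of_nonneg_right hε (Nat.cast_nonneg _)).trans h1)
    ((mul_le_mul_of_nonneg_right hε (Nat.cast_nonneg _)).trans h2)
    ((mul_le_mul_of_nonneg_right hε (Nat.cast_nonneg _)).trans h3)).trans_le hε

variable {ε γ : ℝ} {D : C → Digraph V} (K : CleanClusters ε γ (edgeIndicator D)) (d : ℝ)

/-- Remove from `D` all edges in discarded triples of clusters. -/
def CleanClusters.prune (c : C) : Digraph V where
  Adj x y := (D c).Adj x y ∧ ¬ K.Removed d x y c

namespace CleanClusters

lemma edgeIndicator_prune (x y : V) (c : C) :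
    edgeIndicator D x y c = edgeIndicator (K.prune d) x y c + K.removedPart d x y c := by
  by_cases h : K.Removed d x y c
  · rw [removedPart, if_pos h, edgeIndicator.eq_1 (K.prune d), if_neg fun h' => h'.2 h, zero_add]
  · rw [removedPart_of_not h, add_zero]
    by_cases h' : (D c).Adj x y
    · exact (if_pos h').trans (if_pos (c := (K.prune d c).Adj x y) ⟨h', h⟩).symm
    · exact (if_neg h').trans (if_neg (c := (K.prune d c).Adj x y) fun h'' => h' h''.1).symm

variable {K d}

lemma prune_between_of_discarded {h i : Fin K.L₁} {j : Fin K.M₁} (hd : K.Discarded d h i j) {c : C}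
    (hc : c ∈ K.S₁ j) : between (K.prune d c) (K.A₁ h) (K.A₁ i) = ⊥ := by
  ext x y
  simp only [between, Digraph.bot_adj, iff_false]
  exact fun ⟨hx, hy, _, hr⟩ => hr ⟨h, i, j, hx, hy, hc, hd⟩

/-- Clusters are disjoint, so an edge of a given colour lies in at most one triple of clusters;
pruning leaves a triple that is not discarded intact. -/
lemma isRegular_prune (hε0 : 0 ≤ ε) (hε1 : 2 * ε ≤ 1) {ε' : ℝ} (hε' : 2 * ε ≤ ε')
    {h i : Fin K.L₁} {j : Fin K.M₁} (hd : ¬ K.Discarded d h i j) :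
    IsRegular ε' d (fun c => between (K.prune d c) (K.A₁ h) (K.A₁ i)) (K.S₁ j) (K.A₁ h)
      (K.A₁ i) := by
  have hd' := hd
  simp only [Discarded, not_or, not_not, not_lt] at hd'
  refine isRegular_congr (D := D) (fun c hc x hx y hy => ?_)
    ((slice hε0 hε1 hd'.2.1).1.mono hε') hd'.2.2
  refine ⟨fun hD => ⟨hx, hy, hD, ?_⟩, fun hD => hD.2.2.1⟩
  rintro ⟨h', i', j', hx', hy', hc', hdis⟩
  obtain rfl := K.family_A₁.eq_of_mem hx hx'
  obtain rfl := K.family_A₁.eq_of_mem hy hy'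
  obtain rfl := K.family_S₁.eq_of_mem hc hc'
  exact hd hdis

lemma not_mem_of_prune_adj {x y : V} {c : C} {i : Fin K.L₁} (hx : x ∈ K.A₁ i) (hy : y ∈ K.A₁ i)
    (h : (K.prune d c).Adj x y) (j : Fin K.M₁) : c ∉ K.S₁ j :=
  fun hc => h.2 ⟨i, i, j, hx, hy, hc, Or.inl rfl⟩

lemma numEdges_prune [Fintype V] (c : C) : (numEdges (D c) : ℝ) =
    numEdges (K.prune d c) + ∑ x, ∑ y, K.removedPart d x y c := by
  rw [numEdges, numEdges, edgeCount_eq_sum D, edgeCount_eq_sum (K.prune d),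
    ← Finset.sum_add_distrib]
  refine Finset.sum_congr rfl fun x _ => ?_
  rw [← Finset.sum_add_distrib]
  exact Finset.sum_congr rfl fun y _ => K.edgeIndicator_prune d x y c

variable [Fintype V] [Fintype C]

lemma sum_outDeg_prune (v : V) : ∑ c, (outDeg (D c) v : ℝ) =
    ∑ c, (outDeg (K.prune d c) v : ℝ) + ∑ y, ∑ c, K.removedPart d v y c := by
  rw [Finset.sum_comm (f := fun y c => K.removedPart d v y c), ← Finset.sum_add_distrib]
  refine Finset.sum_congr rfl fun c _ => ?_
  rw [outDeg_eq_sum D, outDeg_eq_sum (K.prune d), ← Finset.sum_add_distrib]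
  exact Finset.sum_congr rfl fun y _ => K.edgeIndicator_prune d v y c

lemma sum_inDeg_prune (v : V) : ∑ c, (inDeg (D c) v : ℝ) =
    ∑ c, (inDeg (K.prune d c) v : ℝ) + ∑ x, ∑ c, K.removedPart d x v c := by
  rw [Finset.sum_comm (f := fun x c => K.removedPart d x v c), ← Finset.sum_add_distrib]
  refine Finset.sum_congr rfl fun c _ => ?_
  rw [inDeg_eq_sum D, inDeg_eq_sum (K.prune d), ← Finset.sum_add_distrib]
  exact Finset.sum_congr rfl fun x _ => K.edgeIndicator_prune d x v c

end CleanClusters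

open Classical in
lemma IsClusterFamily.isClusterPartition {V : Type*} [Fintype V] {L m : ℕ} {A : Fin L → Finset V}
    (h : IsClusterFamily m A) (hm : 0 < m) :
    IsClusterPartition (univ.filter fun x => ∀ i, x ∉ A i) A where
  nonempty i := Finset.card_pos.mp (by rw [h.card_eq]; exact hm)
  disjoint := h.disjoint
  disjoint_exceptional i := Finset.disjoint_left.mpr fun x hx => (mem_filter.mp hx).2 i
  cover x := by
    by_cases hx : ∃ i, x ∈ A i
    · exact Or.inr hx
    · push Not at hx
      exact Or.inl (mem_filter.mpr ⟨mem_univ _, hx⟩)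

end Prune

end DigraphCollection

/-! ### Choice of constants and proof of the regularity lemma. -/

theorem lemma2p2 :
    ∀ (L₀ : ℕ), 1 ≤ L₀ → ∀ (ε δ : ℝ), 0 < ε → 0 < δ →
    ∃ n₀ : ℕ, ∀ (d : ℝ), 0 ≤ d → d < 1 →
    ∀ (V C : Type*) [Fintype V] [Fintype C] (D : C → Digraph V),
      (∀ c, DigraphCollection.Loopless (D c)) →
      ∀ n : ℕ, Fintype.card V = n → n₀ ≤ n →
      δ * (n : ℝ) ≤ (Fintype.card C : ℝ) → (Fintype.card C : ℝ) ≤ (n : ℝ) / δ →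
      ∃ (L M m : ℕ) (V₀ : Finset V) (VC : Fin L → Finset V)
        (C₀ : Finset C) (CC : Fin M → Finset C) (D' : C → Digraph V),
        DigraphCollection.IsClusterPartition V₀ VC ∧
        DigraphCollection.IsClusterPartition C₀ CC ∧
        -- each `D' c` is a spanning sub-digraph of `D c`
        (∀ c, D' c ≤ D c) ∧
        -- numbers of clusters and sizes of the exceptional sets
        (L₀ < L ∧ L < n₀ ∧ L₀ < M ∧ M < n₀ ∧
          (V₀.card : ℝ) + (C₀.card : ℝ) ≤ ε * (n : ℝ)) ∧
        -- all clusters have the same size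
        ((∀ i, (VC i).card = m) ∧ (∀ j, (CC j).card = m)) ∧
        -- few edges are lost
        ((∀ v : V,
            (∑ c, (DigraphCollection.outDeg (D c) v : ℝ)) - (24 * d / δ ^ 3 + ε) * (n : ℝ) ^ 2
              ≤ ∑ c, (DigraphCollection.outDeg (D' c) v : ℝ)) ∧
          (∀ v : V,
            (∑ c, (DigraphCollection.inDeg (D c) v : ℝ)) - (24 * d / δ ^ 3 + ε) * (n : ℝ) ^ 2
              ≤ ∑ c, (DigraphCollection.inDeg (D' c) v : ℝ)) ∧
          (∀ c : C,
            (DigraphCollection.numEdges (D c) : ℝ) - (24 * d / δ ^ 3 + ε) * (n : ℝ) ^ 2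
              ≤ (DigraphCollection.numEdges (D' c) : ℝ))) ∧
        -- edges inside a vertex cluster have exceptional colours only
        (∀ c : C, (∃ i, ∃ x ∈ VC i, ∃ y ∈ VC i, (D' c).Adj x y) → c ∈ C₀) ∧
        -- empty or regular, for every ordered pair of distinct vertex clusters
        (∀ h i : Fin L, h ≠ i → ∀ j : Fin M,
          (∀ c ∈ CC j, DigraphCollection.between (D' c) (VC h) (VC i) = ⊥) ∨
          DigraphCollection.IsRegular ε d
            (fun c => DigraphCollection.between (D' c) (VC h) (VC i)) (CC j) (VC h) (VC i)) := by
  classical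
  intro L₀ _ ε δ hε hδ
  by_cases hδ1 : δ ≤ 1
  swap
  -- For `δ > 1` and `n ≥ 1` no collection satisfies `δ n ≤ |C| ≤ n / δ`.
  · refine ⟨1, fun d _ _ V C _ _ D _ n _ hn h1 h2 => ?_⟩
    exfalso
    have hn' : (1 : ℝ) ≤ n := by exact_mod_cast hn
    have h3 := h1.trans h2
    rw [le_div_iff₀ hδ] at h3
    push Not at hδ1
    have h4 : 1 < δ * δ := by nlinarith
    nlinarith
  -- The bound `δ / 4` keeps at least `δ n / 2` elements covered on each side. Then `2κ + γ + η ≤ ε₁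
  -- δ` controls the losses, `κ` is what cleaning with `γ`, `β` demands, and the second bound on `η`
  -- makes clusters so small that there are more than `L₀`.
  obtain ⟨ε₁, hε₁⟩ : ∃ ε₁, ε₁ = min ε (δ / 4) := ⟨_, rfl⟩
  have hε₁0 : 0 < ε₁ := by rw [hε₁]; positivity
  have hε₁ε : ε₁ ≤ ε := hε₁ ▸ min_le_left _ _
  have hε₁δ : ε₁ ≤ δ / 4 := hε₁ ▸ min_le_right _ _
  obtain ⟨γ, hγ⟩ : ∃ γ, γ = ε₁ * δ / 4 := ⟨_, rfl⟩
  obtain ⟨β, hβ⟩ : ∃ β, β = ε₁ * δ / 16 := ⟨_, rfl⟩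
  obtain ⟨κ, hκ⟩ : ∃ κ, κ = γ * β ^ 2 / 4 := ⟨_, rfl⟩
  obtain ⟨η, hη⟩ : ∃ η, η = min (ε₁ * δ / 8) (δ / (4 * (L₀ + 1))) := ⟨_, rfl⟩
  have hγ0 : 0 < γ := by rw [hγ]; positivity
  have hβ0 : 0 < β := by rw [hβ]; positivity
  have hκ0 : 0 < κ := by rw [hκ]; positivity
  have hη0 : 0 < η := by rw [hη]; positivity
  have hη1 : η ≤ ε₁ * δ / 8 := hη ▸ min_le_left _ _
  have hη2 : η * (4 * (L₀ + 1)) ≤ δ := by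
    rw [← le_div_iff₀ (by positivity)]
    exact hη ▸ min_le_right _ _
  have hεδ : ε₁ * δ ≤ ε₁ := by nlinarith
  have hεδ' : ε₁ * δ ≤ δ / 4 := by nlinarith
  have hβ1 : β ≤ 1 / 16 := by linarith
  have hγ1 : γ ≤ 1 / 4 := by linarith
  have hκγ : 4 * κ ≤ γ := by
    rw [hκ]
    nlinarith [mul_nonneg hβ0.le (sub_nonneg.mpr hβ1)]
  obtain ⟨N, hN⟩ := DigraphCollection.exists_hasRegularClusters (δ := δ) hκ0 hη0
    (by linarith) hδ1
  -- The second term bounds the cluster counts: a selected cluster has size at least `n / (2N)`, and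
  -- each side has at most `n / δ` elements.
  refine ⟨max (N + 1) (⌈2 * N / δ⌉₊ + 1), fun d hd _ V C _ _ D _ n hVn hn hC1 hC2 => ?_⟩
  subst hVn
  set n := Fintype.card V with hVn
  have hn0 : 0 < n := by omega
  have hn0' : (0 : ℝ) < n := by exact_mod_cast hn0
  have hreg := hN V C (DigraphCollection.edgeIndicator D)
    (DigraphCollection.edgeIndicator_nonneg D) (DigraphCollection.edgeIndicator_le_one D)
    (by omega) hC1 hC2
  have hηV : η * n < n := mul_lt_of_lt_one_left hn0' (by linarith)
  have hηC : η * n < Fintype.card C :=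
    (mul_lt_mul_of_pos_right (by linarith) hn0').trans_le hC1
  obtain ⟨K, hmη, hNm, hLV, hMC⟩ := DigraphCollection.exists_cleanClusters hκ0.le (by linarith)
    hγ0 hβ0 (by linarith) (by linarith) _ (by rwa [← hVn]) (by rwa [← hVn])
    hreg
  rw [← hVn] at hmη hNm hLV hMC
  have hm0 : (0 : ℝ) < K.m₁ := by exact_mod_cast K.m₁_pos
  have hm₁m : (K.m₁ : ℝ) ≤ K.m := by exact_mod_cast K.m₁_le
  have hmm₁ : (K.m : ℝ) ≤ 2 * K.m₁ := by exact_mod_cast K.le_m₁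
  have hNm' : (n : ℝ) ≤ N * K.m := by exact_mod_cast hNm
  have hL₁n : (K.L₁ : ℝ) * K.m₁ ≤ n := by exact_mod_cast K.family_A₁.mul_le
  have hM₁n : (K.M₁ : ℝ) * K.m₁ ≤ Fintype.card C := by exact_mod_cast K.family_S₁.mul_le
  have hLn : (K.L : ℝ) * K.m ≤ n := by exact_mod_cast K.family_A.mul_le
  have hMn : (K.M : ℝ) * K.m ≤ Fintype.card C := by exact_mod_cast K.family_S.mul_le
  have hnδ : (n : ℝ) ≤ n / δ := le_div_self hn0'.le hδ hδ1
  -- The argument loses only `d / δ`, which is below the stated coefficient because `δ ≤ 1`.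
  have hcoef : (d + 2 * κ + γ + η) / δ ≤ 24 * d / δ ^ 3 + ε := by
    have h1 : d / δ ≤ 24 * d / δ ^ 3 := by
      rw [div_le_div_iff₀ hδ (by positivity)]
      have h2 : δ ^ 2 ≤ 1 := pow_le_one₀ hδ.le hδ1
      have h3 : d * δ * δ ^ 2 ≤ d * δ * 1 := mul_le_mul_of_nonneg_left h2 (by positivity)
      have h4 : 0 ≤ d * δ := by positivity
      linarith
    have h2 : (2 * κ + γ + η) / δ ≤ ε := by
      rw [div_le_iff₀ hδ]
      have : ε₁ * δ ≤ ε * δ := by gcongr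
      linarith
    calc (d + 2 * κ + γ + η) / δ = d / δ + (2 * κ + γ + η) / δ := by ring
      _ ≤ _ := add_le_add h1 h2
  have hloss : (d + 2 * κ + γ) * ((K.L * K.m) * (K.M * K.m)) + K.m * Fintype.card C ≤
      (24 * d / δ ^ 3 + ε) * (n : ℝ) ^ 2 :=
    calc (d + 2 * κ + γ) * ((K.L * K.m) * (K.M * K.m)) + K.m * Fintype.card C
        ≤ (d + 2 * κ + γ) * (n * (n / δ)) + (η * n) * (n / δ) := by
          have := hMn.trans hC2
          gcongr
      _ = (d + 2 * κ + γ + η) / δ * (n : ℝ) ^ 2 := by ring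
      _ ≤ _ := by gcongr
  have hlossC : (d + 2 * κ + γ) * ((K.L * K.m) * (K.L * K.m)) + K.m * Fintype.card V ≤
      (24 * d / δ ^ 3 + ε) * (n : ℝ) ^ 2 :=
    calc (d + 2 * κ + γ) * ((K.L * K.m) * (K.L * K.m)) + K.m * Fintype.card V
        ≤ (d + 2 * κ + γ) * (n * (n / δ)) + (η * n) * (n / δ) := by
          have := hLn.trans hnδ
          rw [← hVn]
          gcongr
      _ = (d + 2 * κ + γ + η) / δ * (n : ℝ) ^ 2 := by ring
      _ ≤ _ := by gcongr
  have hκ2 : 2 * κ ≤ 1 := by linarith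
  have hf0 := DigraphCollection.edgeIndicator_nonneg D
  have hf1 := DigraphCollection.edgeIndicator_le_one D
  have hβC : 2 * β * Fintype.card C ≤ ε₁ / 8 * n := by
    have h1 : (Fintype.card C : ℝ) * δ ≤ n := by rwa [le_div_iff₀ hδ] at hC2
    have h2 : ε₁ * (Fintype.card C * δ) ≤ ε₁ * n := by gcongr
    rw [hβ]
    linarith only [h2]
  have hβn : 2 * β * n ≤ ε₁ / 8 * n := by
    gcongr
    linarith
  have hηn : η * n ≤ ε₁ / 8 * n := by
    gcongr
    linarith
  have hε₁n : ε₁ * n ≤ δ / 4 * n := by gcongr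
  have hδn : δ * n ≤ n := mul_le_of_le_one_left hn0'.le hδ1
  have hlarge : ∀ {l : ℝ}, δ / 2 * n ≤ l * K.m₁ → (L₀ : ℝ) < l := by
    intro l hl
    have h1 : δ / 2 * K.m₁ ≤ δ / 2 * (η * n) :=
      mul_le_mul_of_nonneg_left (hm₁m.trans hmη) (by positivity)
    have h2 : δ / 2 * K.m₁ ≤ (η * l) * K.m₁ := by
      have := mul_le_mul_of_nonneg_left hl hη0.le
      linarith only [h1, this]
    have h3 : δ / 2 ≤ η * l := le_of_mul_le_mul_right h2 hm0
    have h4 : η * (2 * (L₀ + 1)) ≤ η * l := by linarith only [h3, hη2]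
    have h5 := le_of_mul_le_mul_left h4 hη0
    have h6 : (0 : ℝ) ≤ L₀ := Nat.cast_nonneg _
    linarith only [h5, h6]
  have hsmall : ∀ {l : ℕ}, (l : ℝ) * K.m₁ ≤ n / δ →
      l < max (N + 1) (⌈2 * N / δ⌉₊ + 1) := by
    intro l hl
    have h1 : (l : ℝ) * K.m₁ ≤ 2 * N / δ * K.m₁ := by
      refine hl.trans ?_
      rw [div_mul_eq_mul_div]
      gcongr
      have := mul_le_mul_of_nonneg_left hmm₁ (Nat.cast_nonneg (α := ℝ) N)
      linarith only [this, hNm']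
    have h2 : (l : ℝ) ≤ ⌈2 * N / δ⌉₊ := (le_of_mul_le_mul_right h1 hm0).trans (Nat.le_ceil _)
    have h3 : l ≤ ⌈2 * N / δ⌉₊ := by exact_mod_cast h2
    exact lt_max_of_lt_right (Nat.lt_succ_of_le h3)
  have hV₀ := K.family_A₁.mul_add_card_eq
  have hC₀ := K.family_S₁.mul_add_card_eq
  refine ⟨K.L₁, K.M₁, K.m₁, _, K.A₁, _, K.S₁, K.prune d,
    K.family_A₁.isClusterPartition K.m₁_pos, K.family_S₁.isClusterPartition K.m₁_pos,
    fun c x y h => h.1, ⟨?_, ?_, ?_, ?_, ?_⟩, ⟨K.family_A₁.card_eq, K.family_S₁.card_eq⟩,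
    ⟨fun v => ?_, fun v => ?_, fun c => ?_⟩, ?_, ?_⟩
  · have := hlarge (l := K.L₁)
      (by linarith only [hLV, hβn, hηn, hε₁n, hδn, hn0'])
    exact_mod_cast this
  · exact hsmall (hL₁n.trans hnδ)
  · have := hlarge (l := K.M₁)
      (by linarith only [hMC, hC1, hβC, hηn, hε₁n, hδn, hn0', mul_pos hδ hn0'])
    exact_mod_cast this
  · exact hsmall (hM₁n.trans hC2)
  · have e1 : (K.L₁ : ℝ) * K.m₁ + (Finset.univ.filter fun x => ∀ i, x ∉ K.A₁ i).card = n := by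
      exact_mod_cast hV₀
    have e2 : (K.M₁ : ℝ) * K.m₁ + (Finset.univ.filter fun x => ∀ i, x ∉ K.S₁ i).card =
        Fintype.card C := by
      exact_mod_cast hC₀
    have h3 : ε₁ * n ≤ ε * n := by gcongr
    have h4 : 0 ≤ ε₁ * n := by positivity
    linarith only [e1, e2, h3, h4, hLV, hMC, hβn, hβC, hηn]
  · have := DigraphCollection.CleanClusters.sum_removedPart_out_le (K := K) hκ0.le hκ2 hd hγ0.le
      hf0 hf1 v
    rw [DigraphCollection.CleanClusters.sum_outDeg_prune (K := K) (d := d) v]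
    linarith only [this, hloss]
  · have := DigraphCollection.CleanClusters.sum_removedPart_in_le (K := K) hκ0.le hκ2 hd hγ0.le
      hf0 hf1 v
    rw [DigraphCollection.CleanClusters.sum_inDeg_prune (K := K) (d := d) v]
    linarith only [this, hloss]
  · have := DigraphCollection.CleanClusters.sum_removedPart_colour_le (K := K) hκ0.le hκ2 hd
      hγ0.le hf0 hf1 c
    rw [DigraphCollection.CleanClusters.numEdges_prune (K := K) (d := d) c]
    linarith only [this, hlossC]
  · rintro c ⟨i, x, hx, y, hy, h⟩
    exact Finset.mem_filter.mpr ⟨Finset.mem_univ _,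
      DigraphCollection.CleanClusters.not_mem_of_prune_adj hx hy h⟩
  · intro h i _ j
    by_cases hdis : K.Discarded d h i j
    · exact Or.inl fun c hc =>
        DigraphCollection.CleanClusters.prune_between_of_discarded hdis hc
    · exact Or.inr (DigraphCollection.CleanClusters.isRegular_prune hκ0.le hκ2
        (by linarith) hdis)
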